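/- For a closed slab $\sigma$ in the plane (the region between two parallel lines, possibly degenerate to a single line) of width $w\ge 0$ and for $\varepsilon>0$, the $\varepsilon$-expansion of $\sigma$ is the slab with the same center line and width $(1+\varepsilon)w$. A subset $Q$ of a finite set $S\subset\mathbb R^2$ is an $\varepsilon$-certificate of $S$ if, for any two slabs of the same width whose union covers $Q$, the union of their $\varepsilon$-expansions covers $S$. There are an algorithm on the real RAM with floor function (exact arithmetic $+,-,\times,/$, comparisons, floor and memory accesses on real numbers at unit cost, with rational constants) and an absolute constant $C$ such that, for every finite set $S$ of $n$ points in the plane and every real $\varepsilon>0$, the algorithm, given $S$ (as a list of its points in any order) and $\varepsilon$, computes in at most $C(n+1)$ time an $\varepsilon$-certificate of $S$ with at most $C\max\{1,1/\varepsilon^2\}$ points. In particular, for $0<\varepsilon\le 1$ an $\varepsilon$-certificate of size $O(1/\varepsilon^2)$ can be computed in $O(n)$ time (for $n\ge 1$), where the constants depend neither on $S$ nor on $\varepsilon$. -/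

import Mathlib

namespace TwoLineCenter

/-! ### Slabs and certificates -/

/-- The Euclidean plane. -/
abbrev Plane := EuclideanSpace ℝ (Fin 2)

/-- A closed slab, given by a unit normal vector `u`, its center line `{x | ⟪u, x⟫ = offset}` and
its width, the distance between its two bounding lines `⟪u, x⟫ = offset ± width / 2`.
A slab of width `0` is a line. -/
structure Slab where
  normal : Plane
  norm_normal : ‖normal‖ = 1
  offset : ℝ
  width : ℝ
  width_nonneg : 0 ≤ width

/-- The set of points of the plane that lie in the slab. -/
def Slab.carrier (σ : Slab) : Set Plane :=
  {x | |inner ℝ σ.normal x - σ.offset| ≤ σ.width / 2}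

/-- The `ε`-expansion of a slab: same center line, width `(1 + ε)` times the width. -/
def Slab.expansion (σ : Slab) (ε : ℝ) (hε : 0 < ε) : Slab where
  normal := σ.normal
  norm_normal := σ.norm_normal
  offset := σ.offset
  width := (1 + ε) * σ.width
  width_nonneg := mul_nonneg (by linarith) σ.width_nonneg

/-- `Q` is an `ε`-certificate of `P`: a subset of `P` such that whenever two slabs of the same
width cover `Q`, their `ε`-expansions cover `P`. -/
def IsCertificate (ε : ℝ) (hε : 0 < ε) (P Q : Finset Plane) : Prop :=
  Q ⊆ P ∧
    ∀ σ₁ σ₂ : Slab, σ₁.width = σ₂.width →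
      (Q : Set Plane) ⊆ σ₁.carrier ∪ σ₂.carrier →
        (P : Set Plane) ⊆ (σ₁.expansion ε hε).carrier ∪ (σ₂.expansion ε hε).carrier

/-! ### The real RAM with floor function

Programs are structured programs over real-valued registers and real-valued arrays. A program is a
finite text, so it names finitely many registers, arrays and rational constants; its length does
not depend on the input. Every arithmetic operation, floor operation, memory access, comparison
and control-flow step costs one unit of time. -/

/-- A memory state: real registers `reg 0, reg 1, …` and arrays `arr a` with real cells
`arr a 0, arr a 1, …`. -/
structure State where
  reg : ℕ → ℝ
  arr : ℕ → ℕ → ℝ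

/-- Arithmetic expressions; `read a e` is the cell of array `a` at the address `e`. -/
inductive Expr where
  | const (q : ℚ)
  | reg (r : ℕ)
  | read (a : ℕ) (e : Expr)
  | add (e f : Expr)
  | sub (e f : Expr)
  | mul (e f : Expr)
  | div (e f : Expr)
  | floor (e : Expr)

/-- The value of an expression. Addresses are rounded down to natural numbers (negative values to
`0`) and a quotient by `0` is `0`; a program can exclude both by tests. -/
noncomputable def Expr.eval (s : State) : Expr → ℝ
  | .const q => (q : ℝ)
  | .reg r => s.reg r
  | .read a e => s.arr a ⌊e.eval s⌋₊
  | .add e f => e.eval s + f.eval s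
  | .sub e f => e.eval s - f.eval s
  | .mul e f => e.eval s * f.eval s
  | .div e f => e.eval s / f.eval s
  | .floor e => (⌊e.eval s⌋ : ℝ)

/-- The time for evaluating an expression: one unit for each constant, register access, array
access and operation in it. -/
def Expr.cost : Expr → ℕ
  | .const _ => 1
  | .reg _ => 1
  | .read _ e => e.cost + 1
  | .add e f => e.cost + f.cost + 1
  | .sub e f => e.cost + f.cost + 1
  | .mul e f => e.cost + f.cost + 1
  | .div e f => e.cost + f.cost + 1
  | .floor e => e.cost + 1

/-- Boolean combinations of comparisons of reals. -/
inductive Test where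
  | le (e f : Expr)
  | not (b : Test)
  | and (b c : Test)

/-- The test `b` succeeds in the state `s`. -/
def Test.Holds (s : State) : Test → Prop
  | .le e f => e.eval s ≤ f.eval s
  | .not b => ¬ b.Holds s
  | .and b c => b.Holds s ∧ c.Holds s

/-- The time for evaluating a test. -/
def Test.cost : Test → ℕ
  | .le e f => e.cost + f.cost + 1
  | .not b => b.cost + 1
  | .and b c => b.cost + c.cost + 1

/-- Programs: `set r e` stores the value of `e` in register `r`, `write a i e` stores the value of
`e` in array `a` at the address `i`, and `loop b p` repeats `p` while `b` holds. -/
inductive Program where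
  | skip
  | set (r : ℕ) (e : Expr)
  | write (a : ℕ) (i e : Expr)
  | seq (p q : Program)
  | branch (b : Test) (p q : Program)
  | loop (b : Test) (p : Program)

/-- The state after assigning `v` to register `r`. -/
def State.setReg (s : State) (r : ℕ) (v : ℝ) : State where
  reg := Function.update s.reg r v
  arr := s.arr

/-- The state after assigning `v` to cell `i` of array `a`. -/
def State.setCell (s : State) (a i : ℕ) (v : ℝ) : State where
  reg := s.reg
  arr := Function.update s.arr a (Function.update (s.arr a) i v)

/-- `Runs p s t s'`: started in the state `s`, the program `p` halts after exactly `t` units of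
time in the state `s'`. -/
inductive Runs : Program → State → ℕ → State → Prop
  | skip (s : State) : Runs .skip s 1 s
  | set (s : State) (r : ℕ) (e : Expr) :
      Runs (.set r e) s (e.cost + 1) (s.setReg r (e.eval s))
  | write (s : State) (a : ℕ) (i e : Expr) :
      Runs (.write a i e) s (i.cost + e.cost + 1) (s.setCell a ⌊i.eval s⌋₊ (e.eval s))
  | seq {p q : Program} {s₁ s₂ s₃ : State} {t u : ℕ} :
      Runs p s₁ t s₂ → Runs q s₂ u s₃ → Runs (.seq p q) s₁ (t + u) s₃
  | branch_true {b : Test} {p q : Program} {s s' : State} {t : ℕ} :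
      b.Holds s → Runs p s t s' → Runs (.branch b p q) s (b.cost + t + 1) s'
  | branch_false {b : Test} {p q : Program} {s s' : State} {t : ℕ} :
      ¬ b.Holds s → Runs q s t s' → Runs (.branch b p q) s (b.cost + t + 1) s'
  | loop_done {b : Test} {p : Program} {s : State} :
      ¬ b.Holds s → Runs (.loop b p) s (b.cost + 1) s
  | loop_step {b : Test} {p : Program} {s₁ s₂ s₃ : State} {t u : ℕ} :
      b.Holds s₁ → Runs p s₁ t s₂ → Runs (.loop b p) s₂ u s₃ →
        Runs (.loop b p) s₁ (b.cost + t + u + 1) s₃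

/-- The state `s` stores the finite point set `P`: register `0` holds the number of its points, and
arrays `0` and `1` hold their first and second coordinates, each point once, in some order. -/
def State.Stores (s : State) (P : Finset Plane) : Prop :=
  s.reg 0 = (P.card : ℝ) ∧
    ∃ p : Fin P.card ≃ P, ∀ i : Fin P.card,
      s.arr 0 i = (p i : Plane) 0 ∧ s.arr 1 i = (p i : Plane) 1

end TwoLineCenter

/-!
A certificate is found by reducing a pair of slabs to a pair of segments with ends in the input.

Let two slabs of width `w` cover a set `Q ⊆ S`. Suppose that `Q` contains points `z₁, z₂` of one
slab and `z₃, z₄` of one slab such that all of `Q` is within `O(w)` of the two segments `[z₁, z₂]`,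
`[z₃, z₄]` (dilated by a constant factor). If `Q` also contains a point of `S` farthest from these
segments, then its distance `D` is `O(w)`, and all of `S` is within `D` of the segments. Put a grid
on each segment, with `O(1 / ε)` columns along the segment and `O(1 / ε)` rows of height `ε D`
across it, and let `Q` contain the first and the last point of `S`, in the direction of the segment,
in each cell. These points control their cell (`inStrip_expand_of_cell`): if one of them is in the
slab that contains the ends of the segment, then the whole cell is in the expansion of this slab, as
a cell is thin in the direction of its normal; if both are in the other slab, then the cell points
between them are close to a segment in that slab. This is `covers_of_tuple`; the grid depends only
on the four points, not on the slabs.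

It remains to see that a bounded number of quadruples, found by a bounded number of maximizations
over `S`, serves all pairs of slabs. Let `a`, `b` be points whose distance is comparable with the
diameter of `S`. If two points `x`, `y` at such a distance are in the same slab (`covers_of_pair`),
then every point of this slab is close to `[x, y]`. A highest point `c` above the line `x y` is in
the other slab (or all points are close to the line), and it remains to find a second point of that
slab such that the segment from `c` spans all points that are not close to `[x, y]`. Either the
highest point `f` among those at most half as high as `c` will do, since the heights change linearly
along the slab, or the point `e` farthest from `c` among the higher ones. If no such `x`, `y` exist
(`covers_of_seed`), then `S` consists of two small distant clusters around `a` and `b`, each of them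
belongs to one slab, and a segment from `a` and one from `b` to a farthest point of the cluster form
the quadruple.

On the real RAM, square roots are avoided by measuring with the maximum norm, and all selections are
instances of one loop, the maximization of a key in each of `N` buckets (`halts_bucketMax`). If
there are fewer than about `1 / ε ^ 2` points, then the input itself is returned; otherwise the
grids, with `O(1 / ε ^ 2)` cells, have linear size. The constants: `gauge_le_of_frame` bounds
distances by `26 w` when lengths along a slab are compared up to the factor `6` that
`gauge_le_of_low` needs, for which the dilation factor `20` in `gauge` is large enough; `40` covers
this and the distance `36 w` in `covers_of_pair`; and with `D ≤ 40 w` a cell of side `1 / m` has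
thickness at most `120 w / m`, which is at most `ε w / 2` for `m ≥ 240 / ε`.
-/

namespace TwoLineCenter

/-! ### Plane vectors in coordinates -/

/-- The inner product of two vectors given by their coordinates. -/
def dot (v q : ℝ × ℝ) : ℝ := v.1 * q.1 + v.2 * q.2

/-- The cross product `det (v, q)` of two plane vectors. -/
def crs (v q : ℝ × ℝ) : ℝ := v.1 * q.2 - v.2 * q.1

/-- The maximum norm: within a factor `√2` of the Euclidean one, and computable without square
roots. -/
noncomputable def supNorm (v : ℝ × ℝ) : ℝ := max |v.1| |v.2|

/-- A substitute for the distance of `p` to a dilated copy of the segment `[z, z']`, computable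
without square roots: the distance to the line `z z'`, up to a constant factor, if the projection of
`p` to this line is within `20 |z' - z|` of `z`, and the distance to `z` otherwise (in particular if
`z = z'`). -/
noncomputable def gauge (z z' p : ℝ × ℝ) : ℝ :=
  if 20 * dot (z' - z) (z' - z) ≤ |dot (z' - z) (p - z)| then supNorm (p - z)
  else |crs (z' - z) (p - z)| / supNorm (z' - z)

/-- The point `p` lies in the slab with unit normal `u`, offset `o` and width `w`. -/
def InStrip (u : ℝ × ℝ) (o w : ℝ) (p : ℝ × ℝ) : Prop := |dot u p - o| ≤ w / 2

theorem supNorm_nonneg (v : ℝ × ℝ) : 0 ≤ supNorm v := le_max_of_le_left (abs_nonneg _)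

theorem abs_fst_le_supNorm (v : ℝ × ℝ) : |v.1| ≤ supNorm v := le_max_left _ _
theorem abs_snd_le_supNorm (v : ℝ × ℝ) : |v.2| ≤ supNorm v := le_max_right _ _

theorem supNorm_sub_comm (p q : ℝ × ℝ) : supNorm (p - q) = supNorm (q - p) := by
  simp only [supNorm, Prod.fst_sub, Prod.snd_sub]
  rw [abs_sub_comm p.1, abs_sub_comm p.2]

theorem supNorm_sub_le (p q r : ℝ × ℝ) :
    supNorm (p - r) ≤ supNorm (p - q) + supNorm (q - r) := by
  have h1 := abs_fst_le_supNorm (p - q)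
  have h2 := abs_snd_le_supNorm (p - q)
  have h3 := abs_fst_le_supNorm (q - r)
  have h4 := abs_snd_le_supNorm (q - r)
  simp only [Prod.fst_sub, Prod.snd_sub] at h1 h2 h3 h4
  have e1 := abs_sub_le p.1 q.1 r.1
  have e2 := abs_sub_le p.2 q.2 r.2
  exact max_le (by simp only [Prod.fst_sub]; linarith) (by simp only [Prod.snd_sub]; linarith)

theorem abs_mul_add_mul_le {a b c d x y : ℝ} (ha : |a| ≤ x) (hb : |b| ≤ x) (hc : |c| ≤ y)
    (hd : |d| ≤ y) : |a * c| + |b * d| ≤ 2 * x * y := by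
  have hx : 0 ≤ x := (abs_nonneg _).trans ha
  rw [abs_mul, abs_mul]
  have := mul_le_mul ha hc (abs_nonneg _) hx
  have := mul_le_mul hb hd (abs_nonneg _) hx
  linarith

theorem abs_dot_le (v q : ℝ × ℝ) : |dot v q| ≤ 2 * supNorm v * supNorm q :=
  (abs_add_le _ _).trans (abs_mul_add_mul_le (abs_fst_le_supNorm v) (abs_snd_le_supNorm v)
    (abs_fst_le_supNorm q) (abs_snd_le_supNorm q))

theorem abs_crs_le (v q : ℝ × ℝ) : |crs v q| ≤ 2 * supNorm v * supNorm q :=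
  (abs_sub _ _).trans (abs_mul_add_mul_le (abs_fst_le_supNorm v) (abs_snd_le_supNorm v)
    (abs_snd_le_supNorm q) (abs_fst_le_supNorm q))

theorem supNorm_sq_le_dot_self (v : ℝ × ℝ) : supNorm v ^ 2 ≤ dot v v := by
  unfold supNorm dot
  rcases max_choice |v.1| |v.2| with h | h <;> rw [h, sq_abs] <;>
    nlinarith [sq_nonneg v.1, sq_nonneg v.2]

theorem dot_self_nonneg (v : ℝ × ℝ) : 0 ≤ dot v v :=
  (sq_nonneg _).trans (supNorm_sq_le_dot_self v)

theorem supNorm_eq_zero {v : ℝ × ℝ} (h : supNorm v = 0) : v = 0 := by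
  have h1 := abs_fst_le_supNorm v
  have h2 := abs_snd_le_supNorm v
  rw [h] at h1 h2
  exact Prod.ext (abs_nonpos_iff.1 h1) (abs_nonpos_iff.1 h2)

/-! ### Coordinates along a unit vector and its normal -/

section
variable {u : ℝ × ℝ} (hu : dot u u = 1)
include hu

theorem supNorm_le_one_of_unit : supNorm u ≤ 1 := by
  have := supNorm_sq_le_dot_self u
  nlinarith [supNorm_nonneg u]

theorem abs_crs_unit_le (v : ℝ × ℝ) : |crs u v| ≤ 2 * supNorm v := by
  have := abs_crs_le u v
  have := mul_le_mul_of_nonneg_right (supNorm_le_one_of_unit hu) (supNorm_nonneg v)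
  linarith

theorem dot_eq_unit_frame (v q : ℝ × ℝ) :
    dot v q = dot u v * dot u q + crs u v * crs u q := by
  unfold dot crs at *
  linear_combination (-(v.1 * q.1 + v.2 * q.2)) * hu

theorem crs_eq_unit_frame (v q : ℝ × ℝ) :
    crs v q = dot u v * crs u q - crs u v * dot u q := by
  unfold dot crs at *
  linear_combination (-(v.1 * q.2 - v.2 * q.1)) * hu

theorem supNorm_le_unit_frame (v : ℝ × ℝ) : supNorm v ≤ |dot u v| + |crs u v| := by
  have h := supNorm_sq_le_dot_self v
  rw [dot_eq_unit_frame hu v v] at h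
  refine abs_le_of_sq_le_sq' ?_ (by positivity) |>.2
  nlinarith [abs_nonneg (dot u v), abs_nonneg (crs u v), sq_abs (dot u v), sq_abs (crs u v),
    mul_nonneg (abs_nonneg (dot u v)) (abs_nonneg (crs u v))]

end

/-! ### Distances to segments in a slab -/

theorem gauge_nonneg (z z' p : ℝ × ℝ) : 0 ≤ gauge z z' p := by
  unfold gauge
  split_ifs
  · exact supNorm_nonneg _
  · exact div_nonneg (abs_nonneg _) (supNorm_nonneg _)

/-- If `z`, `z'`, `p` lie in a slab of width `w` with normal `u` and, along the slab, `p` is not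
much farther from `z` than `z'` is, then `p` is within `O(w)` of the segment `[z, z']`. -/
theorem gauge_le_of_frame {u z z' p : ℝ × ℝ} (hu : dot u u = 1) {w : ℝ} (hw : 0 ≤ w)
    (hz : |dot u (z' - z)| ≤ w) (hp : |dot u (p - z)| ≤ w)
    (h : |crs u (p - z)| ≤ 6 * (|crs u (z' - z)| + w)) : gauge z z' p ≤ 26 * w := by
  set v := z' - z
  set q := p - z
  have hs := abs_nonneg (crs u v)
  have hs' := abs_nonneg (crs u q)
  have hq := supNorm_le_unit_frame hu q
  unfold gauge
  split_ifs with hc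
  · have h1 : |dot v q| ≤ w * w + |crs u v| * |crs u q| := by
      rw [dot_eq_unit_frame hu v q]
      refine (abs_add_le _ _).trans ?_
      rw [abs_mul, abs_mul]
      gcongr
    have h2 : |crs u v| ^ 2 ≤ dot v v := by
      rw [dot_eq_unit_frame hu v v, sq_abs]; nlinarith [sq_nonneg (dot u v)]
    have h3 : |crs u v| ≤ w := by
      by_contra! hlt
      nlinarith [mul_le_mul_of_nonneg_left h hs, mul_le_mul hlt.le hlt.le hw hs]
    linarith
  · have hv : 0 < supNorm v := by
      rcases (supNorm_nonneg v).lt_or_eq with h0 | h0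
      · exact h0
      · exact absurd (by rw [show z' - z = 0 from supNorm_eq_zero h0.symm]; simp [dot]) hc
    rw [div_le_iff₀ hv]
    rcases le_total w |crs u v| with h0 | h0
    · have h1 : |crs v q| ≤ w * |crs u q| + |crs u v| * w := by
        rw [crs_eq_unit_frame hu v q]
        refine (abs_sub _ _).trans ?_
        rw [abs_mul, abs_mul]
        gcongr
      have := abs_crs_unit_le hu v
      nlinarith
    · have h1 := abs_crs_le v q
      have : supNorm q ≤ 13 * w := by linarith
      nlinarith

theorem InStrip.abs_dot_sub_le {u p q : ℝ × ℝ} {o w : ℝ} (hp : InStrip u o w p)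
    (hq : InStrip u o w q) : |dot u (p - q)| ≤ w := by
  unfold InStrip at *
  have : dot u (p - q) = (dot u p - o) - (dot u q - o) := by
    simp only [dot, Prod.fst_sub, Prod.snd_sub]; ring
  rw [this]
  refine (abs_sub _ _).trans ?_
  linarith

theorem gauge_le_of_supNorm_le {u z z' p : ℝ × ℝ} (hu : dot u u = 1) {o w : ℝ} (hw : 0 ≤ w)
    (hz : InStrip u o w z) (hz' : InStrip u o w z') (hp : InStrip u o w p)
    (h : supNorm (p - z) ≤ supNorm (z' - z)) : gauge z z' p ≤ 26 * w := by
  have h1 := hz'.abs_dot_sub_le hz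
  refine gauge_le_of_frame hu hw h1 (hp.abs_dot_sub_le hz) ?_
  have h2 := abs_crs_unit_le hu (p - z)
  have h3 := supNorm_le_unit_frame hu (z' - z)
  have := abs_nonneg (crs u (z' - z))
  linarith

/-- The distance of `p` to the line `x y`, multiplied by the length of `y - x`. -/
noncomputable def height (x y p : ℝ × ℝ) : ℝ := |crs (y - x) (p - x)|

theorem height_le_of_inStrip {u x y p : ℝ × ℝ} (hu : dot u u = 1) {o w : ℝ} (hw : 0 ≤ w)
    (hx : InStrip u o w x) (hy : InStrip u o w y) (hp : InStrip u o w p)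
    (h : supNorm (p - x) ≤ 8 * supNorm (y - x)) :
    height x y p ≤ 18 * w * supNorm (y - x) := by
  unfold height
  rw [crs_eq_unit_frame hu]
  refine (abs_sub _ _).trans ?_
  rw [abs_mul, abs_mul]
  have h1 := hy.abs_dot_sub_le hx
  have h2 := hp.abs_dot_sub_le hx
  have h3 := abs_crs_unit_le hu (p - x)
  have h4 := abs_crs_unit_le hu (y - x)
  have h5 : |dot u (y - x)| * |crs u (p - x)| ≤ w * (2 * (8 * supNorm (y - x))) := by
    gcongr; linarith
  have h6 : |crs u (y - x)| * |dot u (p - x)| ≤ (2 * supNorm (y - x)) * w := by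
    gcongr
    have := supNorm_nonneg (y - x); linarith
  linarith

theorem gauge_le_of_height_le {x y p : ℝ × ℝ} {k : ℝ} (hk : 0 ≤ k)
    (h : supNorm (p - x) ≤ 8 * supNorm (y - x)) (hh : height x y p ≤ k * supNorm (y - x)) :
    gauge x y p ≤ k := by
  unfold gauge
  have h0 := supNorm_nonneg (y - x)
  split_ifs with hc
  · have h1 := abs_dot_le (y - x) (p - x)
    have h2 := supNorm_sq_le_dot_self (y - x)
    have h3 : supNorm (y - x) = 0 := by
      by_contra hne
      have : 0 < supNorm (y - x) := lt_of_le_of_ne h0 (Ne.symm hne)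
      nlinarith [mul_le_mul_of_nonneg_left h h0]
    rw [h3] at h
    linarith
  · exact div_le_of_le_mul₀ h0 hk hh

/-! ### Grids along a segment -/

/-- The first axis of the grid for the points within `D` of the segment spanned by `v`: the vector
`v` itself, or a vector of length `D` if the segment is shorter than that. -/
noncomputable def frame (D : ℝ) (v : ℝ × ℝ) : ℝ × ℝ := if D ≤ supNorm v then v else (D, 0)

/-- The coordinate of `p` along the grid of width `D` on the segment `[z, z']`, in multiples of the
length of the frame vector. -/
noncomputable def gridX (D : ℝ) (z z' p : ℝ × ℝ) : ℝ :=
  dot (frame D (z' - z)) (p - z) / dot (frame D (z' - z)) (frame D (z' - z))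

/-- The coordinate of `p` across the grid of width `D` on the segment `[z, z']`, in multiples of
`D`, up to a constant factor. If `D = 0` it is the junk value `0`; all points considered then lie on
the line `z z'`. -/
noncomputable def gridY (D : ℝ) (z z' p : ℝ × ℝ) : ℝ :=
  crs (frame D (z' - z)) (p - z) / (supNorm (frame D (z' - z)) * D)

theorem le_supNorm_frame {D : ℝ} (hD : 0 ≤ D) (v : ℝ × ℝ) : D ≤ supNorm (frame D v) := by
  unfold frame
  split_ifs with h
  · exact h
  · simp [supNorm, abs_of_nonneg hD]

theorem abs_crs_le_of_gauge_le {z z' p : ℝ × ℝ} {D : ℝ} (h : gauge z z' p ≤ D) :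
    |crs (z' - z) (p - z)| ≤ 2 * supNorm (z' - z) * D := by
  unfold gauge at h
  have h0 := supNorm_nonneg (z' - z)
  split_ifs at h with hc
  · refine (abs_crs_le _ _).trans ?_
    gcongr
  · rcases h0.lt_or_eq with h1 | h1
    · rw [div_le_iff₀ h1] at h
      have := abs_nonneg (crs (z' - z) (p - z))
      linarith
    · rw [supNorm_eq_zero h1.symm]; simp [crs, supNorm]

theorem gridY_mul {z z' p : ℝ × ℝ} {D : ℝ} (hD : 0 ≤ D) (h : gauge z z' p ≤ D) :
    crs (frame D (z' - z)) (p - z) =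
      gridY D z z' p * (supNorm (frame D (z' - z)) * D) := by
  unfold gridY
  rcases hD.lt_or_eq with h0 | h0
  · have := le_supNorm_frame hD (z' - z)
    have : 0 < supNorm (frame D (z' - z)) := by linarith
    field_simp
  · subst h0
    have : frame 0 (z' - z) = z' - z := by simp [frame, supNorm_nonneg]
    rw [this]
    have := abs_crs_le_of_gauge_le h
    simp only [mul_zero, div_zero]
    simpa using this

/-- The points within `D` of a segment have bounded grid coordinates, so that cells of side `1 / m`
partition them into `O(m ^ 2)` classes. -/
theorem abs_grid_le {z z' p : ℝ × ℝ} {D : ℝ} (h : gauge z z' p ≤ D) :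
    |gridX D z z' p| ≤ 40 ∧ |gridY D z z' p| ≤ 40 := by
  have hD : 0 ≤ D := (gauge_nonneg _ _ _).trans h
  have hcr := abs_crs_le_of_gauge_le h
  have h0 := supNorm_nonneg (z' - z)
  by_cases hf : D ≤ supNorm (z' - z)
  · simp only [gridX, gridY, frame, if_pos hf]
    rw [abs_div, abs_div, abs_of_nonneg (dot_self_nonneg _), abs_of_nonneg (mul_nonneg h0 hD)]
    constructor
    · refine div_le_of_le_mul₀ (dot_self_nonneg _) (by norm_num) ?_
      unfold gauge at h
      split_ifs at h with hc
      · have h1 := abs_dot_le (z' - z) (p - z)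
        have h2 := supNorm_sq_le_dot_self (z' - z)
        have h3 := mul_le_mul_of_nonneg_left (h.trans hf) h0
        have := dot_self_nonneg (z' - z)
        linarith
      · have := dot_self_nonneg (z' - z)
        linarith
    · refine div_le_of_le_mul₀ (mul_nonneg h0 hD) (by norm_num) ?_
      nlinarith
  · have hf' : supNorm (z' - z) < D := not_le.1 hf
    have hD' : 0 < D := h0.trans_lt hf'
    have hq : supNorm (p - z) ≤ 40 * D := by
      unfold gauge at h
      split_ifs at h with hc
      · linarith
      · have hv : 0 < dot (z' - z) (z' - z) := by
          by_contra hle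
          have := dot_self_nonneg (z' - z)
          exact hc (by rw [show dot (z' - z) (z' - z) = 0 by linarith]; simp)
        have hvv : dot (z' - z) (z' - z) ≤ 2 * D ^ 2 := by
          have := abs_dot_le (z' - z) (z' - z)
          rw [abs_of_pos hv] at this
          nlinarith
        have e : dot (p - z) (p - z) * dot (z' - z) (z' - z) =
            |dot (z' - z) (p - z)| ^ 2 + |crs (z' - z) (p - z)| ^ 2 := by
          rw [sq_abs, sq_abs]; simp only [dot, crs]; ring
        have h1 : |dot (z' - z) (p - z)| ^ 2 ≤ (20 * dot (z' - z) (z' - z)) ^ 2 := by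
          gcongr; exact (not_le.1 hc).le
        have h2 : |crs (z' - z) (p - z)| ^ 2 ≤ 4 * D ^ 2 * dot (z' - z) (z' - z) := by
          calc |crs (z' - z) (p - z)| ^ 2 ≤ (2 * supNorm (z' - z) * D) ^ 2 := by gcongr
            _ = 4 * D ^ 2 * supNorm (z' - z) ^ 2 := by ring
            _ ≤ _ := by gcongr; exact supNorm_sq_le_dot_self _
        have h3 : dot (p - z) (p - z) ≤ 400 * dot (z' - z) (z' - z) + 4 * D ^ 2 := by
          refine le_of_mul_le_mul_right ?_ hv
          nlinarith
        have h4 := supNorm_sq_le_dot_self (p - z)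
        refine abs_le_of_sq_le_sq' (b := 40 * D) ?_ (by positivity) |>.2
        nlinarith
    have h1 := abs_fst_le_supNorm (p - z)
    have h2 := abs_snd_le_supNorm (p - z)
    have hs : supNorm ((D, 0) : ℝ × ℝ) = D := by simp [supNorm, abs_of_nonneg hD, hD]
    have e1 : gridX D z z' p = (p - z).1 / D := by
      simp only [gridX, frame, if_neg hf, dot]; field_simp; ring
    have e2 : gridY D z z' p = (p - z).2 / D := by
      simp only [gridY, frame, if_neg hf, hs, crs]; field_simp; ring
    rw [e1, e2, abs_div, abs_div, abs_of_pos hD', div_le_iff₀ hD', div_le_iff₀ hD']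
    constructor <;> linarith

/-- A displacement of `α` along and `β` across a grid with frame vector `f` moves a point by at most
`α |u · f| + 2 β D` in the direction `u`. -/
theorem abs_dot_unit_le_of_grid {u f r : ℝ × ℝ} (hu : dot u u = 1) (hf : 0 < supNorm f)
    {α β D : ℝ} (hD : 0 ≤ D)
    (h1 : |dot f r| ≤ α * dot f f) (h2 : |crs f r| ≤ β * (supNorm f * D)) (hβ : 0 ≤ β) :
    |dot u r| ≤ α * |dot u f| + 2 * β * D := by
  have hff : 0 < dot f f := lt_of_lt_of_le (by positivity) (supNorm_sq_le_dot_self f)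
  have e : dot f f * dot u r = dot f r * dot u f + crs f r * crs f u := by
    simp only [dot, crs]; ring
  have h3 : |crs f u| ≤ 2 * supNorm f := by
    have : crs f u = - crs u f := by simp only [crs]; ring
    rw [this, abs_neg]; exact abs_crs_unit_le hu f
  have h4 : dot f f * |dot u r| ≤ dot f f * (α * |dot u f| + 2 * β * D) := by
    rw [← abs_of_pos hff, ← abs_mul, e, abs_of_pos hff]
    refine (abs_add_le _ _).trans ?_
    rw [abs_mul, abs_mul]
    have a1 : |dot f r| * |dot u f| ≤ α * dot f f * |dot u f| := by gcongr
    have a2 : |crs f r| * |crs f u| ≤ β * (supNorm f * D) * (2 * supNorm f) := by gcongr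
    have a3 : β * D * supNorm f ^ 2 ≤ β * D * dot f f := by
      gcongr; exact supNorm_sq_le_dot_self f
    linarith
  exact le_of_mul_le_mul_left h4 hff

theorem inStrip_expand {u p q : ℝ × ℝ} {o w ε : ℝ} (hq : InStrip u o w q)
    (h : |dot u (p - q)| ≤ ε * w / 2) : InStrip u o ((1 + ε) * w) p := by
  unfold InStrip at *
  have : dot u p - o = dot u (p - q) + (dot u q - o) := by
    simp only [dot, Prod.fst_sub, Prod.snd_sub]; ring
  rw [this]
  refine (abs_add_le _ _).trans ?_
  linarith

theorem inStrip_expand_self {u p : ℝ × ℝ} {o w ε : ℝ} (hw : 0 ≤ w) (hε : 0 < ε)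
    (hq : InStrip u o w p) : InStrip u o ((1 + ε) * w) p :=
  inStrip_expand hq (by simp [dot]; positivity)

theorem inStrip_convex {u p q : ℝ × ℝ} {o w t : ℝ} (hp : InStrip u o w p) (hq : InStrip u o w q)
    (h0 : 0 ≤ t) (h1 : t ≤ 1) : InStrip u o w ((1 - t) • p + t • q) := by
  unfold InStrip at *
  have : dot u ((1 - t) • p + t • q) - o = (1 - t) * (dot u p - o) + t * (dot u q - o) := by
    simp only [dot, Prod.fst_add, Prod.snd_add, Prod.smul_fst, Prod.smul_snd, smul_eq_mul]; ring
  rw [this]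
  refine (abs_add_le _ _).trans ?_
  rw [abs_mul, abs_mul, abs_of_nonneg h0, abs_of_nonneg (sub_nonneg.2 h1)]
  nlinarith [mul_le_mul_of_nonneg_left hp (sub_nonneg.2 h1), mul_le_mul_of_nonneg_left hq h0]

theorem exists_convex_coeff {x₁ x x₂ : ℝ} (h1 : x₁ ≤ x) (h2 : x ≤ x₂) :
    ∃ t : ℝ, 0 ≤ t ∧ t ≤ 1 ∧ x = (1 - t) * x₁ + t * x₂ := by
  rcases (h1.trans h2).lt_or_eq with h | h
  · refine ⟨(x - x₁) / (x₂ - x₁), div_nonneg (by linarith) (by linarith),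
      (div_le_one (by linarith)).2 (by linarith), ?_⟩
    have : x₂ - x₁ ≠ 0 := by linarith
    field_simp; ring
  · exact ⟨0, le_rfl, zero_le_one, by linarith⟩

/-- The reason why two points per grid cell suffice. Let `z`, `z'` lie in a slab `σ` of width `w`,
let `D ≤ 40 w`, and let `p₁`, `p`, `p₂` be points of one cell of the grid of width `D` on `[z, z']`,
in this order along the segment. Moving `p₁` or `p₂` to `p` changes the distance to the center line
of `σ` by `O(w / m)` only, so that if one of them is in `σ`, then `p` is in the expansion of `σ`.
Otherwise both are in the other slab, which is convex and passes within `O(D / m)` of `p`. -/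
theorem inStrip_expand_of_cell {u u' z z' p p₁ p₂ : ℝ × ℝ} {o o' w ε D m : ℝ}
    (hu : dot u u = 1) (hu' : dot u' u' = 1) (hw : 0 ≤ w) (hε : 0 < ε) (hm : 0 < m)
    (hmε : 240 / ε ≤ m) (hD : D ≤ 40 * w) (hz : InStrip u o w z) (hz' : InStrip u o w z')
    (hp : gauge z z' p ≤ D) (hp₁ : gauge z z' p₁ ≤ D) (hp₂ : gauge z z' p₂ ≤ D)
    (hx₁ : gridX D z z' p₁ ≤ gridX D z z' p) (hx₂ : gridX D z z' p ≤ gridX D z z' p₂)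
    (hX₁ : |gridX D z z' p - gridX D z z' p₁| ≤ 1 / m)
    (hX₂ : |gridX D z z' p - gridX D z z' p₂| ≤ 1 / m)
    (hY₁ : |gridY D z z' p - gridY D z z' p₁| ≤ 1 / m)
    (hY₂ : |gridY D z z' p - gridY D z z' p₂| ≤ 1 / m)
    (h₁ : InStrip u o w p₁ ∨ InStrip u' o' w p₁) (h₂ : InStrip u o w p₂ ∨ InStrip u' o' w p₂) :
    InStrip u o ((1 + ε) * w) p ∨ InStrip u' o' ((1 + ε) * w) p := by
  have hD0 : 0 ≤ D := (gauge_nonneg _ _ _).trans hp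
  set f := frame D (z' - z) with hfdef
  have hm' : 1 / m * w ≤ ε * w / 240 := by
    rw [div_le_iff₀ hε] at hmε
    have : 1 / m ≤ ε / 240 := by
      rw [div_le_div_iff₀ hm (by norm_num)]; linarith
    calc 1 / m * w ≤ ε / 240 * w := by gcongr
      _ = _ := by ring
  have hεw : 0 ≤ ε * w := by positivity
  rcases (supNorm_nonneg f).lt_or_eq with hf | hf
  swap
  · left
    -- a zero frame vector means `D = 0` and `z = z'`, hence `p = z`
    have hDf := le_supNorm_frame hD0 (z' - z)
    rw [← hfdef, ← hf] at hDf
    have hD' : D = 0 := le_antisymm hDf hD0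
    have hv : z' - z = 0 := by
      have h := supNorm_eq_zero hf.symm
      rwa [hfdef, hD', frame, if_pos (supNorm_nonneg _)] at h
    have : gauge z z' p = supNorm (p - z) := by simp [gauge, hv, dot]
    rw [this, hD'] at hp
    have := supNorm_eq_zero (le_antisymm hp (supNorm_nonneg _))
    rw [sub_eq_zero.1 this]
    exact inStrip_expand_self hw hε hz
  have hff : 0 < dot f f := lt_of_lt_of_le (by positivity) (supNorm_sq_le_dot_self f)
  have hX : ∀ q, dot f (q - z) = gridX D z z' q * dot f f := fun q => by
    unfold gridX; rw [← hfdef]; field_simp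
  have hY : ∀ q, gauge z z' q ≤ D → crs f (q - z) = gridY D z z' q * (supNorm f * D) :=
    fun q hq => gridY_mul hD0 hq
  have huf : |dot u f| ≤ 40 * w := by
    have h1 := hz'.abs_dot_sub_le hz
    rw [hfdef]; unfold frame
    split_ifs with h
    · linarith
    · simp only [dot, mul_zero, add_zero, abs_mul, abs_of_nonneg hD0]
      have := (abs_fst_le_supNorm u).trans (supNorm_le_one_of_unit hu)
      nlinarith
  have key : ∀ q, gauge z z' q ≤ D → |gridX D z z' p - gridX D z z' q| ≤ 1 / m →
      |gridY D z z' p - gridY D z z' q| ≤ 1 / m → InStrip u o w q →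
      InStrip u o ((1 + ε) * w) p := by
    intro q hq hXq hYq hs
    refine inStrip_expand hs ?_
    have e1 : dot f (p - q) = (gridX D z z' p - gridX D z z' q) * dot f f := by
      rw [sub_mul, ← hX, ← hX]; simp only [dot, Prod.fst_sub, Prod.snd_sub]; ring
    have e2 : crs f (p - q) = (gridY D z z' p - gridY D z z' q) * (supNorm f * D) := by
      rw [sub_mul, ← hY p hp, ← hY q hq]; simp only [crs, Prod.fst_sub, Prod.snd_sub]; ring
    have := abs_dot_unit_le_of_grid (u := u) (f := f) (r := p - q) (α := 1 / m) (β := 1 / m) hu hf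
      hD0 (by rw [e1, abs_mul, abs_of_pos hff]; gcongr)
      (by rw [e2, abs_mul, abs_of_nonneg (mul_nonneg hf.le hD0)]; gcongr) (by positivity)
    have a1 : 1 / m * |dot u f| ≤ 1 / m * (40 * w) := by gcongr
    have a2 : 2 * (1 / m) * D ≤ 2 * (1 / m) * (40 * w) := by gcongr
    linarith
  rcases h₁ with h₁ | h₁
  · exact Or.inl (key p₁ hp₁ hX₁ hY₁ h₁)
  rcases h₂ with h₂ | h₂
  · exact Or.inl (key p₂ hp₂ hX₂ hY₂ h₂)
  right
  obtain ⟨t, ht0, ht1, ht⟩ := exists_convex_coeff hx₁ hx₂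
  refine inStrip_expand (inStrip_convex h₁ h₂ ht0 ht1) ?_
  set r := p - ((1 - t) • p₁ + t • p₂) with hr
  have e1 : dot f r = 0 := by
    have : dot f r = dot f (p - z) - ((1 - t) * dot f (p₁ - z) + t * dot f (p₂ - z)) := by
      simp only [hr, dot, Prod.fst_sub, Prod.snd_sub, Prod.fst_add, Prod.snd_add, Prod.smul_fst,
        Prod.smul_snd, smul_eq_mul]; ring
    rw [this, hX, hX, hX, ht]; ring
  have e2 : crs f r = ((1 - t) * (gridY D z z' p - gridY D z z' p₁) +
      t * (gridY D z z' p - gridY D z z' p₂)) * (supNorm f * D) := by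
    have : crs f r = crs f (p - z) - ((1 - t) * crs f (p₁ - z) + t * crs f (p₂ - z)) := by
      simp only [hr, crs, Prod.fst_sub, Prod.snd_sub, Prod.fst_add, Prod.snd_add, Prod.smul_fst,
        Prod.smul_snd, smul_eq_mul]; ring
    rw [this, hY p hp, hY p₁ hp₁, hY p₂ hp₂]; ring
  have e3 : |(1 - t) * (gridY D z z' p - gridY D z z' p₁) +
      t * (gridY D z z' p - gridY D z z' p₂)| ≤ 1 / m := by
    refine (abs_add_le _ _).trans ?_
    rw [abs_mul, abs_mul, abs_of_nonneg ht0, abs_of_nonneg (sub_nonneg.2 ht1)]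
    nlinarith [mul_le_mul_of_nonneg_left hY₁ (sub_nonneg.2 ht1), mul_le_mul_of_nonneg_left hY₂ ht0]
  have := abs_dot_unit_le_of_grid (u := u') (f := f) (r := r) (α := 0) (β := 1 / m) hu' hf hD0
    (by rw [e1]; simp)
    (by rw [e2, abs_mul, abs_of_nonneg (mul_nonneg hf.le hD0)]; gcongr) (by positivity)
  have a2 : 2 * (1 / m) * D ≤ 2 * (1 / m) * (40 * w) := by gcongr
  linarith

/-! ### Conditions for a certificate -/

/-- The distance of `p` to the union of two segments, in the sense of `gauge`. -/
noncomputable def pairGauge (z₁ z₂ z₃ z₄ p : ℝ × ℝ) : ℝ := min (gauge z₁ z₂ p) (gauge z₃ z₄ p)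

/-- The distance of `p` to `a` for the points `p` closer to `a` than to `b`. The value `-1` excludes
the other points from a maximization. -/
noncomputable def keyNear (a b p : ℝ × ℝ) : ℝ :=
  if supNorm (p - a) ≤ supNorm (p - b) then supNorm (p - a) else -1

/-- The distance of `p` to `c` for the points `p` at least half as high as `c` above the line `x y`;
`-1` for the others. -/
noncomputable def keyHigh (x y c p : ℝ × ℝ) : ℝ :=
  if height x y c / 2 ≤ height x y p then supNorm (p - c) else -1

/-- The height of `p` above the line `x y` for the points less than half as high as `c`; `-1` for
the others. -/
noncomputable def keyLow (x y c p : ℝ × ℝ) : ℝ :=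
  if height x y c / 2 ≤ height x y p then -1 else height x y p

/-- For every point of `S` within `D` of the segment `[z, z']`, the set `Q` contains points of the
same cell (of side `1 / m`) of the grid on `[z, z']` before and after it. -/
def GridGood (S Q : Set (ℝ × ℝ)) (m : ℝ) (z z' : ℝ × ℝ) (D : ℝ) : Prop :=
  ∀ p ∈ S, gauge z z' p ≤ D → ∃ p₁ ∈ Q, ∃ p₂ ∈ Q, gauge z z' p₁ ≤ D ∧ gauge z z' p₂ ≤ D ∧
    gridX D z z' p₁ ≤ gridX D z z' p ∧ gridX D z z' p ≤ gridX D z z' p₂ ∧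
    |gridX D z z' p - gridX D z z' p₁| ≤ 1 / m ∧ |gridX D z z' p - gridX D z z' p₂| ≤ 1 / m ∧
    |gridY D z z' p - gridY D z z' p₁| ≤ 1 / m ∧ |gridY D z z' p - gridY D z z' p₂| ≤ 1 / m

/-- `Q` contains a point of `S` farthest from the union of `[z₁, z₂]` and `[z₃, z₄]` and is dense in
the grids on these segments whose width `D` is the distance of that point. -/
def TupleGood (S Q : Set (ℝ × ℝ)) (m : ℝ) (z₁ z₂ z₃ z₄ : ℝ × ℝ) : Prop :=
  ∃ p ∈ Q, IsMaxOn (pairGauge z₁ z₂ z₃ z₄) S p ∧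
    GridGood S Q m z₁ z₂ (pairGauge z₁ z₂ z₃ z₄ p) ∧ GridGood S Q m z₃ z₄ (pairGauge z₁ z₂ z₃ z₄ p)

/-- What `Q` has to contain in order to deal with all pairs of slabs one of which passes through the
two points `x`, `y` at a distance comparable with the diameter of `S`: the point `c` is highest
above the line `x y`, and `e`, `f` are the candidates for a second point on the slab through `c`. -/
def PairGood (S Q : Set (ℝ × ℝ)) (m : ℝ) (x y : ℝ × ℝ) : Prop :=
  ∃ c ∈ Q, ∃ e ∈ Q, ∃ f ∈ Q, IsMaxOn (height x y) S c ∧ IsMaxOn (keyHigh x y c) S e ∧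
    IsMaxOn (keyLow x y c) S f ∧ TupleGood S Q m x y x y ∧ TupleGood S Q m x y c e ∧
    TupleGood S Q m x y c f

/-- What `Q` has to contain in order to be a certificate. The distance of `a` and `b` is comparable
with the diameter of `S`, and `[a, a']`, `[b, b']` span the points closer to `a` and to `b`. -/
def SeedGood (S Q : Set (ℝ × ℝ)) (m : ℝ) : Prop :=
  ∃ a ∈ Q, ∃ b ∈ Q, ∃ a' ∈ Q, ∃ b' ∈ Q, ∃ p ∈ Q, IsMaxOn (fun q => supNorm (q - a)) S b ∧
    IsMaxOn (keyNear a b) S a' ∧ IsMaxOn (keyNear b a) S b' ∧ IsMaxOn (pairGauge a a' b b') S p ∧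
    TupleGood S Q m a a' b b' ∧
    ∀ x ∈ ({a, b, a', b', p} : Set (ℝ × ℝ)), ∀ y ∈ ({a, b, a', b', p} : Set (ℝ × ℝ)),
      PairGood S Q m x y

theorem height_nonneg (x y p : ℝ × ℝ) : 0 ≤ height x y p := abs_nonneg _

/-! ### Covering by two slabs -/

/-- Two slabs of the same width, by unit normals and offsets in coordinates. -/
structure TwoStrips where
  u : Fin 2 → ℝ × ℝ
  o : Fin 2 → ℝ
  w : ℝ
  unit : ∀ i, dot (u i) (u i) = 1
  w_nonneg : 0 ≤ w

/-- The point `p` lies in the slab of index `i`. -/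
def TwoStrips.Mem (σ : TwoStrips) (i : Fin 2) (p : ℝ × ℝ) : Prop := InStrip (σ.u i) (σ.o i) σ.w p

/-- The slabs with the same center lines and the width `w` cover `S`. -/
def TwoStrips.Covers (σ : TwoStrips) (w : ℝ) (S : Set (ℝ × ℝ)) : Prop :=
  ∀ p ∈ S, ∃ i, InStrip (σ.u i) (σ.o i) w p

theorem exists_fin_two_iff {P : Fin 2 → Prop} (i : Fin 2) : (∃ j, P j) ↔ P i ∨ P (i + 1) := by
  rw [Fin.exists_fin_two]
  fin_cases i
  · simp
  · simp [or_comm]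

section
variable {S Q : Set (ℝ × ℝ)} {m ε : ℝ} (σ : TwoStrips)

/-- If each of two segments has its ends in one of the slabs and the points of `Q` are within `O(w)`
of their union, then all points of `S` are, and the grids on the segments give the claim. -/
theorem covers_of_tuple (hε : 0 < ε) (hm : 0 < m) (hmε : 240 / ε ≤ m)
    (hQ : σ.Covers σ.w Q) {z₁ z₂ z₃ z₄ : ℝ × ℝ} (hT : TupleGood S Q m z₁ z₂ z₃ z₄)
    {i j : Fin 2} (h₁ : σ.Mem i z₁) (h₂ : σ.Mem i z₂) (h₃ : σ.Mem j z₃) (h₄ : σ.Mem j z₄)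
    (hD : ∀ p ∈ Q, IsMaxOn (pairGauge z₁ z₂ z₃ z₄) S p →
      gauge z₁ z₂ p ≤ 40 * σ.w ∨ gauge z₃ z₄ p ≤ 40 * σ.w) :
    σ.Covers ((1 + ε) * σ.w) S := by
  obtain ⟨s, hsQ, hmax, hg₁, hg₂⟩ := hT
  have hDle : pairGauge z₁ z₂ z₃ z₄ s ≤ 40 * σ.w := min_le_iff.2 (hD s hsQ hmax)
  have key : ∀ (z z' : ℝ × ℝ) (i : Fin 2), σ.Mem i z → σ.Mem i z' →
      GridGood S Q m z z' (pairGauge z₁ z₂ z₃ z₄ s) → ∀ p ∈ S,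
      gauge z z' p ≤ pairGauge z₁ z₂ z₃ z₄ s → ∃ i, InStrip (σ.u i) (σ.o i) ((1 + ε) * σ.w) p := by
    intro z z' i hz hz' hg p hp hpD
    obtain ⟨p₁, hp₁, p₂, hp₂, g₁, g₂, x₁, x₂, X₁, X₂, Y₁, Y₂⟩ := hg p hp hpD
    rw [exists_fin_two_iff i]
    exact inStrip_expand_of_cell (σ.unit _) (σ.unit _) σ.w_nonneg hε hm hmε hDle hz hz' hpD g₁ g₂
      x₁ x₂ X₁ X₂ Y₁ Y₂ ((exists_fin_two_iff i).1 (hQ p₁ hp₁))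
      ((exists_fin_two_iff i).1 (hQ p₂ hp₂))
  intro p hp
  rcases min_le_iff.1 (isMaxOn_iff.1 hmax p hp) with h | h
  · exact key z₁ z₂ i h₁ h₂ hg₁ p hp h
  · exact key z₃ z₄ j h₃ h₄ hg₂ p hp h

/-- Let `c`, `f`, `p` lie in a slab of width `w` and let `p` be at most as high and `f` at most half
as high as `c` above (or below) the line `x y`. As heights change linearly along the slab, the
distance of `p` to `c` is at most a constant multiple of that of `f`, so that `p` is close to `[c,
f]`. -/
theorem gauge_le_of_low {u x y c f p : ℝ × ℝ} (hu : dot u u = 1) {o w : ℝ} (hw : 0 ≤ w)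
    (hc : InStrip u o w c) (hf : InStrip u o w f) (hp : InStrip u o w p)
    (h : 36 * w * supNorm (y - x) < height x y c) (hpc : height x y p ≤ height x y c)
    (hfc : height x y f ≤ height x y c / 2) : gauge c f p ≤ 26 * w := by
  refine gauge_le_of_frame hu hw (hf.abs_dot_sub_le hc) (hp.abs_dot_sub_le hc) ?_
  set v := y - x with hv
  -- heights change along the strip at the constant rate `dot u v`
  have hcross : ∀ q, crs v (q - x) - crs v (c - x) = crs v (q - c) := fun q => by
    simp only [crs, Prod.fst_sub, Prod.snd_sub]; ring
  have hlin : ∀ q, crs v (q - c) = dot u v * crs u (q - c) - crs u v * dot u (q - c) :=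
    fun q => crs_eq_unit_frame hu v (q - c)
  have herr : ∀ q, InStrip u o w q → |crs u v * dot u (q - c)| ≤ 2 * supNorm v * w := by
    intro q hq
    rw [abs_mul]
    have h0 := supNorm_nonneg v
    gcongr
    · exact abs_crs_unit_le hu v
    · exact hq.abs_dot_sub_le hc
  have ep := herr p hp
  have ef := herr f hf
  have h1 : |dot u v| * |crs u (p - c)| ≤ 2 * height x y c + 2 * supNorm v * w := by
    rw [← abs_mul]
    have : dot u v * crs u (p - c) =
        crs v (p - x) - crs v (c - x) + crs u v * dot u (p - c) := by
      rw [hcross, hlin]; ring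
    rw [this]
    refine (abs_add_le _ _).trans (add_le_add ((abs_sub _ _).trans ?_) ep)
    have : |crs v (p - x)| ≤ height x y c := hpc
    have : |crs v (c - x)| = height x y c := rfl
    linarith
  have h2 : height x y c / 2 - 2 * supNorm v * w ≤ |dot u v| * |crs u (f - c)| := by
    rw [← abs_mul]
    have : crs v (c - x) = crs v (f - x) - dot u v * crs u (f - c) + crs u v * dot u (f - c) := by
      linarith [hcross f, hlin f]
    have h3 : height x y c ≤ |crs v (f - x)| + |dot u v * crs u (f - c)| +
        |crs u v * dot u (f - c)| := by
      have : height x y c =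
          |crs v (f - x) - dot u v * crs u (f - c) + crs u v * dot u (f - c)| := by
        rw [← this]; rfl
      rw [this]
      exact (abs_add_le _ _).trans (add_le_add_left (abs_sub _ _) _)
    have : |crs v (f - x)| ≤ height x y c / 2 := hfc
    linarith
  have h0 := mul_nonneg hw (supNorm_nonneg v)
  have h3 : |dot u v| * |crs u (p - c)| ≤ |dot u v| * (6 * |crs u (f - c)|) := by nlinarith
  have h4 : 0 < |dot u v| := by
    by_contra hle
    have : |dot u v| = 0 := le_antisymm (not_lt.1 hle) (abs_nonneg _)
    rw [this] at h2
    linarith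
  have := le_of_mul_le_mul_left h3 h4
  linarith

/-- The case that two points `x`, `y` of `Q` at a distance comparable with the diameter of `S` lie
in the same slab. A point `c` highest above the line `x y` is in the other slab, unless all points
are within `O(w)` of the line. If the highest point `f` that is less than half as high as `c` is in
the other slab, too, then `[x, y]` and `[c, f]` are close to all points of the certificate. If it is
not, then all such low points are close to `[x, y]`, and the high ones are close to `[c, e]`, where
`e` is the high point farthest from `c`. -/
theorem covers_of_pair (hε : 0 < ε) (hm : 0 < m) (hmε : 240 / ε ≤ m) (hQS : Q ⊆ S)
    (hQ : σ.Covers σ.w Q) {x y : ℝ × ℝ} (hP : PairGood S Q m x y)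
    {i : Fin 2} (hx : σ.Mem i x) (hy : σ.Mem i y)
    (hfar : ∀ p ∈ S, supNorm (p - x) ≤ 8 * supNorm (y - x)) :
    σ.Covers ((1 + ε) * σ.w) S := by
  obtain ⟨c, hc, e, he, f, hf, mc, me, mf, T₀, T₁, T₂⟩ := hP
  have hw := σ.w_nonneg
  have hν := supNorm_nonneg (y - x)
  have hwν := mul_nonneg hw hν
  -- a point of the strip through `x`, `y` is low, and low points are near the segment
  have hlow : ∀ p ∈ S, σ.Mem i p → height x y p ≤ 18 * σ.w * supNorm (y - x) := fun p hp hpi =>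
    height_le_of_inStrip (σ.unit i) hw hx hy hpi (hfar p hp)
  have hgauge : ∀ p ∈ S, height x y p ≤ 36 * σ.w * supNorm (y - x) → gauge x y p ≤ 40 * σ.w :=
    fun p hp h => (gauge_le_of_height_le (by positivity) (hfar p hp) h).trans (by linarith)
  by_cases hcl : height x y c ≤ 36 * σ.w * supNorm (y - x)
  · exact covers_of_tuple σ hε hm hmε hQ T₀ hx hy hx hy fun p hp _ =>
      Or.inl (hgauge p (hQS hp) ((mc (hQS hp)).trans hcl))
  push Not at hcl
  have hnot : ∀ p ∈ S, height x y c / 2 ≤ height x y p → ¬ σ.Mem i p := fun p hp h hpi => by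
    have := hlow p hp hpi
    linarith
  have hother : ∀ p ∈ Q, ¬ σ.Mem i p → σ.Mem (i + 1) p := fun p hp h =>
    ((exists_fin_two_iff i).1 (hQ p hp)).resolve_left h
  have hcc : height x y c / 2 ≤ height x y c := by linarith [height_nonneg x y c]
  have hci := hother c hc (hnot c (hQS hc) hcc)
  have hehigh : height x y c / 2 ≤ height x y e := by
    by_contra h
    have := me (hQS hc)
    simp only [Set.mem_ofPred_eq, keyHigh, if_pos hcc, if_neg h] at this
    linarith [supNorm_nonneg (c - c)]
  have hei := hother e he (hnot e (hQS he) hehigh)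
  by_cases hfi : height x y f < height x y c / 2 ∧ ¬ σ.Mem i f
  · have hfj := hother f hf hfi.2
    refine covers_of_tuple σ hε hm hmε hQ T₂ hx hy hci hfj fun p hp _ => ?_
    by_cases hpi : σ.Mem i p
    · have := hlow p (hQS hp) hpi
      exact Or.inl (hgauge p (hQS hp) (by linarith))
    · right
      have := gauge_le_of_low (σ.unit _) hw hci hfj (hother p hp hpi) hcl (mc (hQS hp)) hfi.1.le
      linarith
  · refine covers_of_tuple σ hε hm hmε hQ T₁ hx hy hci hei fun p hp _ => ?_
    by_cases hph : height x y c / 2 ≤ height x y p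
    · right
      have hpj := hother p hp (hnot p (hQS hp) hph)
      have hpe := me (hQS hp)
      simp only [Set.mem_ofPred_eq, keyHigh, if_pos hph, if_pos hehigh] at hpe
      have := gauge_le_of_supNorm_le (σ.unit _) hw hci hei hpj hpe
      linarith
    · left
      have hpf := mf (hQS hp)
      simp only [Set.mem_ofPred_eq, keyLow, if_neg hph] at hpf
      by_cases hfh : height x y c / 2 ≤ height x y f
      · rw [if_pos hfh] at hpf
        linarith [height_nonneg x y p]
      · rw [if_neg hfh] at hpf
        have hfi' : σ.Mem i f := by
          by_contra h
          exact hfi ⟨not_le.1 hfh, h⟩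
        have := hlow f (hQS hf) hfi'
        exact hgauge p (hQS hp) (by linarith)

/-- Either two points at a distance comparable with the diameter lie in the same slab, or the points
form two distant clusters, one for each slab. -/
theorem covers_of_seed (hε : 0 < ε) (hm : 0 < m) (hmε : 240 / ε ≤ m) (hQS : Q ⊆ S)
    (hseed : SeedGood S Q m) (hQ : σ.Covers σ.w Q) : σ.Covers ((1 + ε) * σ.w) S := by
  obtain ⟨a, ha, b, hb, a', ha', b', hb', p, hp, mb, ma', mb', mp, T, hP⟩ := hseed
  have hw := σ.w_nonneg
  have hdiam : ∀ x ∈ S, ∀ q ∈ S, supNorm (q - x) ≤ 2 * supNorm (b - a) := fun x hx q hq => by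
    have h1 := mb hx
    have h2 := mb hq
    have h3 := supNorm_sub_le q a x
    rw [supNorm_sub_comm a x] at h3
    simp only [Set.mem_ofPred_eq] at h1 h2
    linarith
  have hpair : ∀ x ∈ ({a, b, a', b', p} : Set (ℝ × ℝ)), ∀ y ∈ ({a, b, a', b', p} : Set (ℝ × ℝ)),
      x ∈ Q → ∀ i, σ.Mem i x → σ.Mem i y → supNorm (b - a) / 4 ≤ supNorm (y - x) →
      σ.Covers ((1 + ε) * σ.w) S := fun x hx y hy hxQ i hxi hyi h =>
    covers_of_pair σ hε hm hmε hQS hQ (hP x hx y hy) hxi hyi fun q hq => by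
      have := hdiam x (hQS hxQ) q hq
      linarith
  have hab := supNorm_nonneg (b - a)
  have hpigeon : ∀ c ∈ ({a, b, a', b', p} : Set (ℝ × ℝ)), c ∈ Q →
      supNorm (b - a) / 4 ≤ supNorm (c - a) → supNorm (b - a) / 4 ≤ supNorm (c - b) →
      σ.Covers ((1 + ε) * σ.w) S := by
    intro c hc hcQ h1 h2
    obtain ⟨i, hi⟩ := hQ a ha
    rcases (exists_fin_two_iff i).1 (hQ c hcQ) with h | h
    · exact hpair a (by simp) c hc ha i hi h h1
    rcases (exists_fin_two_iff i).1 (hQ b hb) with h' | h'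
    · exact hpair a (by simp) b (by simp) ha i hi h' (by linarith)
    · exact hpair b (by simp) c hc hb (i + 1) h' h h2
  have hnear : ∀ {a b a' : ℝ × ℝ}, a ∈ S → IsMaxOn (keyNear a b) S a' →
      supNorm (a' - a) ≤ supNorm (a' - b) ∧ ∀ q ∈ S, supNorm (q - a) ≤ supNorm (q - b) →
        supNorm (q - a) ≤ supNorm (a' - a) := by
    intro a b a' ha hmax
    have h0 : supNorm (a - a) ≤ supNorm (a - b) := by
      have : supNorm (a - a) = 0 := by simp [supNorm]
      rw [this]; exact supNorm_nonneg _
    have h1 : supNorm (a' - a) ≤ supNorm (a' - b) := by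
      by_contra h
      have := hmax ha
      simp only [Set.mem_ofPred_eq, keyNear, if_pos h0, if_neg h] at this
      linarith [supNorm_nonneg (a - a)]
    refine ⟨h1, fun q hq h => ?_⟩
    have := hmax hq
    simpa only [Set.mem_ofPred_eq, keyNear, if_pos h, if_pos h1] using this
  obtain ⟨na, na'⟩ := hnear (hQS ha) ma'
  obtain ⟨nb, nb'⟩ := hnear (hQS hb) mb'
  by_cases h1 : supNorm (b - a) / 4 ≤ supNorm (a' - a)
  · exact hpigeon a' (by simp) ha' h1 (h1.trans na)
  by_cases h2 : supNorm (b - a) / 4 ≤ supNorm (b' - b)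
  · exact hpigeon b' (by simp) hb' (h2.trans nb) h2
  push Not at h1 h2
  -- from here on, the points closer to `a` and those closer to `b` are two distant clusters
  have hcross : ∀ x y, supNorm (x - a) ≤ supNorm (a' - a) → supNorm (y - b) ≤ supNorm (b' - b) →
      supNorm (b - a) / 4 ≤ supNorm (y - x) := fun x y hx hy => by
    have e1 := supNorm_sub_le b y a
    have e2 := supNorm_sub_le y x a
    rw [supNorm_sub_comm b y] at e1
    linarith
  have h0 : ∀ z z' : ℝ × ℝ, supNorm (z - z) ≤ supNorm z' := fun z z' => by
    have : supNorm (z - z) = 0 := by simp [supNorm]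
    rw [this]; exact supNorm_nonneg _
  by_cases hsame : ∃ x ∈ ({a, b, a', b', p} : Set (ℝ × ℝ)), ∃ y ∈ ({a, b, a', b', p} : Set (ℝ × ℝ)),
      x ∈ Q ∧ supNorm (x - a) ≤ supNorm (a' - a) ∧ supNorm (y - b) ≤ supNorm (b' - b) ∧
        ∃ i, σ.Mem i x ∧ σ.Mem i y
  · obtain ⟨x, hx, y, hy, hxQ, hxa, hyb, i, hxi, hyi⟩ := hsame
    exact hpair x hx y hy hxQ i hxi hyi (hcross x y hxa hyb)
  push Not at hsame
  obtain ⟨i, hi⟩ := hQ a ha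
  have hbs : ∀ y ∈ ({a, b, a', b', p} : Set (ℝ × ℝ)), y ∈ Q →
      supNorm (y - b) ≤ supNorm (b' - b) → σ.Mem (i + 1) y := fun y hy hyQ h =>
    ((exists_fin_two_iff i).1 (hQ y hyQ)).resolve_left
      (hsame a (by simp) y hy ha (h0 _ _) h i hi)
  have hbi := hbs b (by simp) hb (h0 _ _)
  have has : ∀ x ∈ ({a, b, a', b', p} : Set (ℝ × ℝ)), x ∈ Q →
      supNorm (x - a) ≤ supNorm (a' - a) → σ.Mem i x := fun x hx hxQ h =>
    ((exists_fin_two_iff i).1 (hQ x hxQ)).resolve_right fun h' =>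
      hsame x hx b (by simp) hxQ h (h0 _ _) (i + 1) h' hbi
  have hai' := has a' (by simp) ha' le_rfl
  have hbi' := hbs b' (by simp) hb' le_rfl
  have hpD : pairGauge a a' b b' p ≤ 40 * σ.w := by
    rcases le_total (supNorm (p - a)) (supNorm (p - b)) with h | h
    · have h' := na' p (hQS hp) h
      have := gauge_le_of_supNorm_le (σ.unit i) hw hi hai' (has p (by simp) hp h') h'
      exact (min_le_left _ _).trans (by linarith)
    · have h' := nb' p (hQS hp) h
      have := gauge_le_of_supNorm_le (σ.unit _) hw hbi hbi' (hbs p (by simp) hp h') h'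
      exact (min_le_right _ _).trans (by linarith)
  exact covers_of_tuple σ hε hm hmε hQ T hi hai' hbi hbi' fun q hq _ =>
    min_le_iff.1 ((mp (hQS hq)).trans hpD)

end

/-! ### Running time of programs -/

/-- A bound for the running time of a program without loops; a loop counts as `0`. -/
def Program.bound : Program → ℕ
  | .skip => 1
  | .set _ e => e.cost + 1
  | .write _ i e => i.cost + e.cost + 1
  | .seq p q => p.bound + q.bound
  | .branch b p q => b.cost + (p.bound + q.bound) + 1
  | .loop _ _ => 0

/-- Started in `s`, the program `p` halts within `T` units of time in a state with `Post`. -/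
def Halts (p : Program) (s : State) (T : ℕ) (Post : State → Prop) : Prop :=
  ∃ t s', Runs p s t s' ∧ t ≤ T ∧ Post s'

/-- Total correctness for programs without loops. -/
def Does (p : Program) (s : State) (Post : State → Prop) : Prop := Halts p s p.bound Post

theorem Halts.mono {p : Program} {s : State} {T T' : ℕ} {Post Post' : State → Prop}
    (h : Halts p s T Post) (hT : T ≤ T') (hP : ∀ s', Post s' → Post' s') : Halts p s T' Post' := by
  obtain ⟨t, s', hr, ht, hp⟩ := h
  exact ⟨t, s', hr, ht.trans hT, hP _ hp⟩

theorem Halts.seq {p q : Program} {s : State} {T T' : ℕ} {Post : State → Prop}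
    (h : Halts p s T fun s' => Halts q s' T' Post) : Halts (.seq p q) s (T + T') Post := by
  obtain ⟨t, s', hr, ht, t', s'', hr', ht', hp⟩ := h
  exact ⟨_, s'', .seq hr hr', add_le_add ht ht', hp⟩

theorem does_skip {s : State} {Post : State → Prop} (h : Post s) : Does .skip s Post :=
  ⟨_, s, .skip s, le_rfl, h⟩

theorem does_set {s : State} {Post : State → Prop} {r : ℕ} {e : Expr}
    (h : Post (s.setReg r (e.eval s))) : Does (.set r e) s Post :=
  ⟨_, _, .set s r e, le_rfl, h⟩

theorem does_write {s : State} {Post : State → Prop} {a : ℕ} {i e : Expr}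
    (h : Post (s.setCell a ⌊i.eval s⌋₊ (e.eval s))) : Does (.write a i e) s Post :=
  ⟨_, _, .write s a i e, le_rfl, h⟩

theorem does_seq {p q : Program} {s : State} {Post : State → Prop}
    (h : Does p s fun s' => Does q s' Post) : Does (.seq p q) s Post :=
  Halts.seq h

theorem Halts.branch {b : Test} {p q : Program} {s : State} {T T' : ℕ} {Post : State → Prop}
    (h₁ : b.Holds s → Halts p s T Post) (h₂ : ¬ b.Holds s → Halts q s T' Post) :
    Halts (.branch b p q) s (b.cost + (T + T') + 1) Post := by
  by_cases hb : b.Holds s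
  · obtain ⟨t, s', hr, ht, hp⟩ := h₁ hb
    exact ⟨_, s', .branch_true hb hr, by omega, hp⟩
  · obtain ⟨t, s', hr, ht, hp⟩ := h₂ hb
    exact ⟨_, s', .branch_false hb hr, by omega, hp⟩

theorem does_branch {b : Test} {p q : Program} {s : State} {Post : State → Prop}
    (h₁ : b.Holds s → Does p s Post) (h₂ : ¬ b.Holds s → Does q s Post) :
    Does (.branch b p q) s Post :=
  Halts.branch h₁ h₂

/-- Run `body` with the values `0, 1, …, e - 1` in register `2`. -/
def forLoop (e : Expr) (body : Program) : Program :=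
  .seq (.set 2 (.const 0))
    (.loop (.not (.le e (.reg 2))) (.seq body (.set 2 (.add (.reg 2) (.const 1)))))

/-- The rule for counting loops with a loop invariant `I`, which may not mention the counter. -/
theorem halts_forLoop {e : Expr} {body : Program} {N : ℕ} {I : ℕ → State → Prop}
    (hI : ∀ i s v, I i s → I i (s.setReg 2 v)) (he : ∀ i s, I i s → e.eval s = N)
    (hbody : ∀ i < N, ∀ s : State, s.reg 2 = (i : ℝ) → I i s →
      Does body s fun s' => s'.reg 2 = i ∧ I (i + 1) s')
    {s : State} (hs : I 0 s) :
    Halts (forLoop e body) s ((body.bound + e.cost + 10) * (N + 1)) (I N) := by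
  have main : ∀ (k i : ℕ) (s : State), i + k = N → s.reg 2 = (i : ℝ) → I i s →
      Halts (.loop (.not (.le e (.reg 2))) (.seq body (.set 2 (.add (.reg 2) (.const 1))))) s
        ((body.bound + e.cost + 8) * k + (e.cost + 4)) (I N) := by
    intro k
    induction k with
    | zero =>
      intro i s hi hr hs
      obtain rfl : i = N := hi
      refine ⟨_, s, .loop_done ?_, ?_, hs⟩
      · simp [Test.Holds, Expr.eval, hr, he _ s hs]
      · simp [Test.cost, Expr.cost]
    | succ k ih =>
      intro i s hi hr hs
      obtain ⟨t, s', hrun, ht, hr', hs'⟩ := hbody i (by omega) s hr hs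
      have hlt : (i : ℝ) < N := by exact_mod_cast (by omega : i < N)
      obtain ⟨t₂, s₂, hrun₂, ht₂, hp₂⟩ := ih (i + 1)
        (s'.setReg 2 ((Expr.add (.reg 2) (.const 1)).eval s')) (by omega)
        (by simp [State.setReg, Expr.eval, hr']) (hI _ _ _ hs')
      refine ⟨_, s₂, .loop_step ?_ (.seq hrun (.set _ _ _)) hrun₂, ?_, hp₂⟩
      · simpa [Test.Holds, Expr.eval, hr, he _ s hs] using hlt
      · simp only [Test.cost, Expr.cost]
        linarith
  have h := main N 0 (s.setReg 2 ((Expr.const 0).eval s)) (by omega)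
    (by simp [State.setReg, Expr.eval]) (hI _ _ _ hs)
  obtain ⟨t, s', hrun, ht, hp⟩ := h
  refine ⟨_, s', .seq (.set _ _ _) hrun, ?_, hp⟩
  simp only [Expr.cost]
  linarith

@[simp] theorem State.setReg_reg (s : State) (r : ℕ) (v : ℝ) :
    (s.setReg r v).reg = Function.update s.reg r v := rfl
@[simp] theorem State.setReg_arr (s : State) (r : ℕ) (v : ℝ) : (s.setReg r v).arr = s.arr := rfl
@[simp] theorem State.setCell_reg (s : State) (a i : ℕ) (v : ℝ) :
    (s.setCell a i v).reg = s.reg := rfl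
@[simp] theorem State.setCell_arr (s : State) (a i : ℕ) (v : ℝ) :
    (s.setCell a i v).arr = Function.update s.arr a (Function.update (s.arr a) i v) := rfl

/-! ### Maximization in buckets -/

/-- Among the points `i < n` that pass the test `incl`, find for each bucket `c < N` (given by
`cell`) one with the largest `key`, and mark it in array `2`. Register `5` holds `N`, register `2`
the index `i` of the current point; array `3` holds the best index found for each bucket, or `-1`,
and array `4` its key. -/
def bucketMax (incl : Test) (cell key : Expr) : Program :=
  .seq (forLoop (.reg 5) (.write 3 (.reg 2) (.const (-1))))
  (.seq (forLoop (.reg 0) (.branch incl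
      (.seq (.set 3 cell) (.seq (.set 4 key)
        (.branch (.and (.le (.const 0) (.read 3 (.reg 3))) (.le (.reg 4) (.read 4 (.reg 3)))) .skip
          (.seq (.write 3 (.reg 3) (.reg 2)) (.write 4 (.reg 3) (.reg 4))))))
      .skip))
    (forLoop (.reg 5) (.branch (.le (.const 0) (.read 3 (.reg 2)))
      (.write 2 (.read 3 (.reg 2)) (.const 1)) .skip)))

/-- The states agree on the registers other than `2`, `3`, `4` and on the coordinates of the points:
the part of the memory that `bucketMax` does not change. -/
structure Frame (s s' : State) : Prop where
  reg : ∀ r, r < 2 ∨ 5 ≤ r → s'.reg r = s.reg r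
  arr0 : s'.arr 0 = s.arr 0
  arr1 : s'.arr 1 = s.arr 1

theorem Frame.refl (s : State) : Frame s s := ⟨fun _ _ => rfl, rfl, rfl⟩

theorem Frame.setReg {s s' : State} (h : Frame s s') {r : ℕ} (hr : 2 ≤ r ∧ r < 5) (v : ℝ) :
    Frame s (s'.setReg r v) := by
  refine ⟨fun r' hr' => ?_, h.arr0, h.arr1⟩
  rw [State.setReg_reg, Function.update_of_ne (by omega)]
  exact h.reg r' hr'

theorem Frame.setCell {s s' : State} (h : Frame s s') {a : ℕ} (ha : 2 ≤ a) (i : ℕ) (v : ℝ) :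
    Frame s (s'.setCell a i v) := by
  refine ⟨h.reg, ?_, ?_⟩
  · rw [State.setCell_arr, Function.update_of_ne (by omega)]; exact h.arr0
  · rw [State.setCell_arr, Function.update_of_ne (by omega)]; exact h.arr1

/-- The index `j` has the largest key among those that satisfy `I` and are in bucket `c`. -/
def BestIn (n : ℕ) (I : ℕ → Prop) (cell : ℕ → ℕ) (key : ℕ → ℝ) (c j : ℕ) : Prop :=
  j < n ∧ I j ∧ cell j = c ∧ ∀ k < n, I k → cell k = c → key k ≤ key j

/-- At most `N` points are marked by `bucketMax`, among them the winner of each nonempty bucket. -/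
theorem halts_bucketMax {incl : Test} {cell key : Expr} {s : State} {n N : ℕ}
    (hn : s.reg 0 = n) (hN : s.reg 5 = N) {I : ℕ → Prop} {cellf : ℕ → ℕ} {keyf : ℕ → ℝ}
    (hI : ∀ s', Frame s s' → ∀ i < n, s'.reg 2 = i → (incl.Holds s' ↔ I i))
    (hcell : ∀ s', Frame s s' → ∀ i < n, s'.reg 2 = i → I i → cell.eval s' = cellf i)
    (hkey : ∀ s', Frame s s' → ∀ i < n, s'.reg 2 = i → I i → key.eval s' = keyf i) :
    Halts (bucketMax incl cell key) s
      ((incl.cost + cell.cost + key.cost + 100) * (n + 1) + 60 * (N + 1)) fun s' =>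
      Frame s s' ∧ ∃ F ⊆ Finset.range n, F.card ≤ N ∧
        (∀ a, s'.arr 2 a = if a ∈ F then 1 else s.arr 2 a) ∧
        ∀ c < N, (∀ j < n, I j → cellf j ≠ c) ∨
          ∃ j ∈ F, BestIn n I cellf keyf c j ∧ s'.arr 3 c = j ∧ s'.arr 4 c = keyf j := by
  have h1 := halts_forLoop (e := .reg 5) (body := .write 3 (.reg 2) (.const (-1))) (N := N)
    (I := fun i s' => Frame s s' ∧ s'.arr 2 = s.arr 2 ∧ ∀ c < i, s'.arr 3 c = -1)
    (fun i s' v h => ⟨h.1.setReg (by omega) v, h.2⟩)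
    (fun i s' h => by simpa [Expr.eval, hN] using h.1.reg 5 (by omega))
    (fun i _ s' hr h => does_write (by
      refine ⟨hr, h.1.setCell (by omega) _ _, ?_, fun c hc => ?_⟩
      · simpa using h.2.1
      · rcases Nat.lt_succ_iff_lt_or_eq.1 hc with hc | rfl
        · have := h.2.2 c hc
          by_cases hci : c = i
          · omega
          · simpa [Expr.eval, hr, Function.update_of_ne hci] using this
        · simp [Expr.eval, hr]))
    (s := s) ⟨Frame.refl s, rfl, by simp⟩
  have h2 : ∀ s₁, (Frame s s₁ ∧ s₁.arr 2 = s.arr 2 ∧ ∀ c < N, s₁.arr 3 c = -1) →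
      Halts (forLoop (.reg 0) (.branch incl
      (.seq (.set 3 cell) (.seq (.set 4 key)
        (.branch (.and (.le (.const 0) (.read 3 (.reg 3))) (.le (.reg 4) (.read 4 (.reg 3)))) .skip
          (.seq (.write 3 (.reg 3) (.reg 2)) (.write 4 (.reg 3) (.reg 4))))))
      .skip)) s₁ ((incl.cost + cell.cost + key.cost + 60) * (n + 1)) fun s' =>
        Frame s s' ∧ s'.arr 2 = s.arr 2 ∧ ∀ c < N,
          (s'.arr 3 c = -1 ∧ ∀ j < n, I j → cellf j ≠ c) ∨
            ∃ j, BestIn n I cellf keyf c j ∧ s'.arr 3 c = j ∧ s'.arr 4 c = keyf j := by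
    intro s₁ hs₁
    refine (halts_forLoop (N := n) (I := fun i s' => Frame s s' ∧ s'.arr 2 = s.arr 2 ∧ ∀ c < N,
          (s'.arr 3 c = -1 ∧ ∀ j < i, I j → cellf j ≠ c) ∨
            ∃ j, BestIn i I cellf keyf c j ∧ s'.arr 3 c = j ∧ s'.arr 4 c = keyf j)
      (fun i s' v h => ⟨h.1.setReg (by omega) v, h.2⟩)
      (fun i s' h => by simpa [Expr.eval, hn] using h.1.reg 0 (by omega)) ?_
      ⟨hs₁.1, hs₁.2.1, fun c hc => Or.inl ⟨hs₁.2.2 c hc, by simp⟩⟩).mono ?_ (fun _ h => h)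
    swap
    · refine Nat.mul_le_mul_right _ ?_
      simp only [Program.bound, Test.cost, Expr.cost]
      omega
    intro i hi s' hr h
    obtain ⟨hf, ha2, htab⟩ := h
    -- entries of the table that are not affected by the point `i`
    have hkeep : ∀ c, (I i → cellf i ≠ c) →
        ((s'.arr 3 c = -1 ∧ ∀ j < i, I j → cellf j ≠ c) ∨
            ∃ j, BestIn i I cellf keyf c j ∧ s'.arr 3 c = j ∧ s'.arr 4 c = keyf j) →
        ((s'.arr 3 c = -1 ∧ ∀ j < i + 1, I j → cellf j ≠ c) ∨
            ∃ j, BestIn (i + 1) I cellf keyf c j ∧ s'.arr 3 c = j ∧ s'.arr 4 c = keyf j) := by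
      rintro c hc (⟨h1, h2⟩ | ⟨j, ⟨b1, b2, b3, b4⟩, h1, h2⟩)
      · refine Or.inl ⟨h1, fun j hj hIj => ?_⟩
        rcases Nat.lt_succ_iff_lt_or_eq.1 hj with hj | rfl
        · exact h2 j hj hIj
        · exact hc hIj
      · refine Or.inr ⟨j, ⟨by omega, b2, b3, fun k hk hIk hck => ?_⟩, h1, h2⟩
        rcases Nat.lt_succ_iff_lt_or_eq.1 hk with hk | rfl
        · exact b4 k hk hIk hck
        · exact absurd hck (hc hIk)
    refine does_branch (fun hincl => ?_) (fun hincl => ?_)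
    · have hIi := (hI s' hf i hi hr).1 hincl
      have hce := hcell s' hf i hi hr hIi
      refine does_seq (does_set (does_seq (does_set ?_)))
      have hf1 := hf.setReg (r := 3) (by omega) (cell.eval s')
      have hke := hkey _ hf1 i hi (by simpa using hr) hIi
      rw [hke, hce]
      rw [hce] at hf1
      have hf2 := hf1.setReg (r := 4) (by omega) (keyf i)
      have hstay : ∀ c < N, c ≠ cellf i → ((s'.arr 3 c = -1 ∧ ∀ j < i + 1, I j → cellf j ≠ c) ∨
            ∃ j, BestIn (i + 1) I cellf keyf c j ∧ s'.arr 3 c = j ∧ s'.arr 4 c = keyf j) :=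
        fun c hc hne => hkeep c (fun _ h => hne h.symm) (htab c hc)
      refine does_branch (fun hb => does_skip ?_) (fun hb => does_seq (does_write (does_write ?_)))
      · refine ⟨by simpa using hr, hf2, ha2, fun c hc => ?_⟩
        by_cases hne : c = cellf i
        swap
        · exact hstay c hc hne
        subst hne
        simp [Test.Holds, Expr.eval] at hb
        rcases htab _ hc with ⟨h1, -⟩ | ⟨j, ⟨b1, b2, b3, b4⟩, h1, h2⟩
        · rw [h1] at hb; norm_num at hb
        · refine Or.inr ⟨j, ⟨by omega, b2, b3, fun k hk hIk hck => ?_⟩, h1, h2⟩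
          rcases Nat.lt_succ_iff_lt_or_eq.1 hk with hk | rfl
          · exact b4 k hk hIk hck
          · rw [h2] at hb; exact hb.2
      · refine ⟨by simpa using hr, (hf2.setCell (by omega) _ _).setCell (by omega) _ _,
          by simpa using ha2, fun c hc => ?_⟩
        by_cases hne : c = cellf i
        swap
        · simpa [Expr.eval, Function.update_of_ne hne] using hstay c hc hne
        subst hne
        refine Or.inr ⟨i, ⟨by omega, hIi, rfl, fun k hk hIk hck => ?_⟩, by simp [Expr.eval, hr],
          by simp [Expr.eval]⟩
        rcases Nat.lt_succ_iff_lt_or_eq.1 hk with hk | rfl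
        swap
        · exact le_rfl
        simp [Test.Holds, Expr.eval] at hb
        rcases htab _ hc with ⟨-, h1⟩ | ⟨j, ⟨b1, b2, b3, b4⟩, h1, h2⟩
        · exact absurd hck (h1 k hk hIk)
        · rw [h1, h2] at hb
          exact (b4 k hk hIk hck).trans (hb (Nat.cast_nonneg j)).le
    · refine does_skip ⟨hr, hf, ha2, fun c hc => hkeep c (fun h => ?_) (htab c hc)⟩
      exact absurd ((hI s' hf i hi hr).2 h) hincl
  have h3 : ∀ s₂, (Frame s s₂ ∧ s₂.arr 2 = s.arr 2 ∧ ∀ c < N,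
          (s₂.arr 3 c = -1 ∧ ∀ j < n, I j → cellf j ≠ c) ∨
            ∃ j, BestIn n I cellf keyf c j ∧ s₂.arr 3 c = j ∧ s₂.arr 4 c = keyf j) →
      Halts (forLoop (.reg 5) (.branch (.le (.const 0) (.read 3 (.reg 2)))
        (.write 2 (.read 3 (.reg 2)) (.const 1)) .skip)) s₂ (40 * (N + 1)) fun s' =>
      Frame s s' ∧ ∃ F ⊆ Finset.range n, F.card ≤ N ∧
        (∀ a, s'.arr 2 a = if a ∈ F then 1 else s.arr 2 a) ∧
        ∀ c < N, (∀ j < n, I j → cellf j ≠ c) ∨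
          ∃ j ∈ F, BestIn n I cellf keyf c j ∧ s'.arr 3 c = j ∧ s'.arr 4 c = keyf j := by
    intro s₂ ⟨hf₂, ha₂, htab⟩
    refine (halts_forLoop (N := N) (I := fun i s' => Frame s s' ∧ s'.arr 3 = s₂.arr 3 ∧
        s'.arr 4 = s₂.arr 4 ∧ ∃ F ⊆ Finset.range n, F.card ≤ i ∧
        (∀ a, s'.arr 2 a = if a ∈ F then 1 else s.arr 2 a) ∧
        ∀ c < i, (∀ j < n, I j → cellf j ≠ c) ∨
          ∃ j ∈ F, BestIn n I cellf keyf c j ∧ s'.arr 3 c = j ∧ s'.arr 4 c = keyf j)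
      (fun i s' v h => ⟨h.1.setReg (by omega) v, h.2⟩)
      (fun i s' h => by simpa [Expr.eval, hN] using h.1.reg 5 (by omega)) ?_
      ⟨hf₂, rfl, rfl, ∅, by simp, by simp, by simp [ha₂], by simp⟩).mono ?_
      (fun _ h => ⟨h.1, h.2.2.2⟩)
    swap
    · refine Nat.mul_le_mul_right _ ?_
      simp only [Program.bound, Test.cost, Expr.cost]
      omega
    intro i hi s' hr ⟨hf, ha3, ha4, F, hF, hFc, hm, hF'⟩
    refine does_branch (fun hb => does_write ?_) (fun hb => does_skip ?_)
    · simp [Test.Holds, Expr.eval, hr, ha3] at hb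
      rcases htab i hi with ⟨h1, -⟩ | ⟨j, hj, h1, h2⟩
      · rw [h1] at hb; norm_num at hb
      refine ⟨by simpa using hr, hf.setCell (by omega) _ _, by simpa using ha3, by simpa using ha4,
        insert j F, ?_, ?_, ?_, ?_⟩
      · rw [Finset.insert_subset_iff]
        exact ⟨Finset.mem_range.2 hj.1, hF⟩
      · exact (Finset.card_insert_le _ _).trans (by omega)
      · intro a
        by_cases haj : a = j
        · subst haj; simp [Expr.eval, hr, ha3, h1]
        · simp [Expr.eval, hr, ha3, h1, haj, hm]
      · intro c hc
        rcases Nat.lt_succ_iff_lt_or_eq.1 hc with hc | rfl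
        · rcases hF' c hc with h | ⟨j', hj', h⟩
          · exact Or.inl h
          · refine Or.inr ⟨j', Finset.mem_insert_of_mem hj', ?_⟩
            simpa using h
        · refine Or.inr ⟨j, Finset.mem_insert_self _ _, hj, ?_⟩
          simp [ha3, ha4, h1, h2]
    · refine ⟨hr, hf, ha3, ha4, F, hF, by omega, hm, fun c hc => ?_⟩
      rcases Nat.lt_succ_iff_lt_or_eq.1 hc with hc | rfl
      · exact hF' c hc
      · rcases htab c hi with ⟨-, h⟩ | ⟨j, hj, h1, h2⟩
        · exact Or.inl h
        · simp [Test.Holds, Expr.eval, hr, ha3, h1] at hb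
  refine Halts.mono (Halts.seq (h1.mono le_rfl fun s₁ hs₁ =>
    Halts.seq ((h2 s₁ hs₁).mono le_rfl fun s₂ hs₂ => h3 s₂ hs₂))) ?_ (fun _ h => h)
  simp only [Program.bound, Expr.cost]
  have := Nat.mul_le_mul_right (n + 1)
    (by omega : incl.cost + cell.cost + key.cost + 60 ≤ incl.cost + cell.cost + key.cost + 100)
  linarith

/-! ### Expressions for the geometric quantities -/

/-- The expression `if e ≤ f then a else b`: as `|x| < x ^ 2 + 1`, the floor of `x / (x ^ 2 + 1)` is
`0` or `-1` according to the sign of `x = f - e`. -/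
def iteE (e f a b : Expr) : Expr :=
  .add b (.mul (.add (.const 1)
    (.floor (.div (.sub f e) (.add (.mul (.sub f e) (.sub f e)) (.const 1))))) (.sub a b))

theorem one_add_floor_div (x : ℝ) : (1 : ℝ) + ⌊x / (x * x + 1)⌋ = if 0 ≤ x then 1 else 0 := by
  have h : 0 < x * x + 1 := by nlinarith [mul_self_nonneg x]
  split_ifs with hx
  · have : ⌊x / (x * x + 1)⌋ = 0 := by
      rw [Int.floor_eq_zero_iff]
      exact ⟨by positivity, (div_lt_one h).2 (by nlinarith [sq_nonneg (x - 1)])⟩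
    simp [this]
  · have : ⌊x / (x * x + 1)⌋ = -1 := by
      rw [Int.floor_eq_iff]
      push Not at hx
      constructor
      · rw [le_div_iff₀ h]; push_cast; nlinarith [sq_nonneg (x + 1)]
      · push_cast; rw [div_lt_iff₀ h]; linarith
    simp [this]

@[simp] theorem eval_iteE (s : State) (e f a b : Expr) :
    (iteE e f a b).eval s = if e.eval s ≤ f.eval s then a.eval s else b.eval s := by
  simp only [iteE, Expr.eval, Rat.cast_one, one_add_floor_div, sub_nonneg]
  split_ifs <;> ring

def absE (e : Expr) : Expr := iteE (.const 0) e e (.sub (.const 0) e)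

def minE (e f : Expr) : Expr := iteE e f e f

def maxE (e f : Expr) : Expr := iteE e f f e

@[simp] theorem eval_absE (s : State) (e : Expr) : (absE e).eval s = |e.eval s| := by
  simp only [absE, eval_iteE, Expr.eval, Rat.cast_zero, zero_sub]
  split_ifs with h
  · rw [abs_of_nonneg h]
  · rw [abs_of_neg (not_le.1 h)]

@[simp] theorem eval_minE (s : State) (e f : Expr) :
    (minE e f).eval s = min (e.eval s) (f.eval s) := by
  simp only [minE, eval_iteE, min_def]

@[simp] theorem eval_maxE (s : State) (e f : Expr) :
    (maxE e f).eval s = max (e.eval s) (f.eval s) := by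
  simp only [maxE, eval_iteE, max_def]

/-- The value of a pair of expressions for the coordinates of a point. -/
noncomputable def evalP (s : State) (p : Expr × Expr) : ℝ × ℝ := (p.1.eval s, p.2.eval s)

/-- The point whose index is stored in register `r`. -/
def ptE (r : ℕ) : Expr × Expr := (.read 0 (.reg r), .read 1 (.reg r))

def subE (p q : Expr × Expr) : Expr × Expr := (.sub p.1 q.1, .sub p.2 q.2)

def dotE (v q : Expr × Expr) : Expr := .add (.mul v.1 q.1) (.mul v.2 q.2)

def crsE (v q : Expr × Expr) : Expr := .sub (.mul v.1 q.2) (.mul v.2 q.1)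

def supE (v : Expr × Expr) : Expr := maxE (absE v.1) (absE v.2)

def gaugeE (z z' p : Expr × Expr) : Expr :=
  iteE (.mul (.const 20) (dotE (subE z' z) (subE z' z))) (absE (dotE (subE z' z) (subE p z)))
    (supE (subE p z)) (.div (absE (crsE (subE z' z) (subE p z))) (supE (subE z' z)))

def heightE (x y p : Expr × Expr) : Expr := absE (crsE (subE y x) (subE p x))

def pairGaugeE (z₁ z₂ z₃ z₄ p : Expr × Expr) : Expr := minE (gaugeE z₁ z₂ p) (gaugeE z₃ z₄ p)

def keyNearE (a b p : Expr × Expr) : Expr :=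
  iteE (supE (subE p a)) (supE (subE p b)) (supE (subE p a)) (.const (-1))

def keyHighE (x y c p : Expr × Expr) : Expr :=
  iteE (.div (heightE x y c) (.const 2)) (heightE x y p) (supE (subE p c)) (.const (-1))

def keyLowE (x y c p : Expr × Expr) : Expr :=
  iteE (.div (heightE x y c) (.const 2)) (heightE x y p) (.const (-1)) (heightE x y p)

def frameE (D : Expr) (v : Expr × Expr) : Expr × Expr :=
  (iteE D (supE v) v.1 D, iteE D (supE v) v.2 (.const 0))

def gridXE (D : Expr) (z z' p : Expr × Expr) : Expr :=
  .div (dotE (frameE D (subE z' z)) (subE p z))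
    (dotE (frameE D (subE z' z)) (frameE D (subE z' z)))

def gridYE (D : Expr) (z z' p : Expr × Expr) : Expr :=
  .div (crsE (frameE D (subE z' z)) (subE p z)) (.mul (supE (frameE D (subE z' z))) D)

section
variable (s : State)

@[simp] theorem evalP_subE (p q : Expr × Expr) : evalP s (subE p q) = evalP s p - evalP s q := rfl
@[simp] theorem eval_dotE (v q : Expr × Expr) :
    (dotE v q).eval s = dot (evalP s v) (evalP s q) := rfl
@[simp] theorem eval_crsE (v q : Expr × Expr) :
    (crsE v q).eval s = crs (evalP s v) (evalP s q) := rfl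
@[simp] theorem eval_supE (v : Expr × Expr) : (supE v).eval s = supNorm (evalP s v) := by
  simp [supE, supNorm, evalP]
@[simp] theorem eval_gaugeE (z z' p : Expr × Expr) :
    (gaugeE z z' p).eval s = gauge (evalP s z) (evalP s z') (evalP s p) := by
  simp [gaugeE, gauge, Expr.eval]
@[simp] theorem eval_heightE (x y p : Expr × Expr) :
    (heightE x y p).eval s = height (evalP s x) (evalP s y) (evalP s p) := by
  simp [heightE, height]
@[simp] theorem eval_pairGaugeE (z₁ z₂ z₃ z₄ p : Expr × Expr) : (pairGaugeE z₁ z₂ z₃ z₄ p).eval s =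
    pairGauge (evalP s z₁) (evalP s z₂) (evalP s z₃) (evalP s z₄) (evalP s p) := by
  simp [pairGaugeE, pairGauge]
@[simp] theorem eval_keyNearE (a b p : Expr × Expr) :
    (keyNearE a b p).eval s = keyNear (evalP s a) (evalP s b) (evalP s p) := by
  simp [keyNearE, keyNear, Expr.eval]
@[simp] theorem eval_keyHighE (x y c p : Expr × Expr) : (keyHighE x y c p).eval s =
    keyHigh (evalP s x) (evalP s y) (evalP s c) (evalP s p) := by
  simp [keyHighE, keyHigh, Expr.eval]
@[simp] theorem eval_keyLowE (x y c p : Expr × Expr) : (keyLowE x y c p).eval s =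
    keyLow (evalP s x) (evalP s y) (evalP s c) (evalP s p) := by
  simp [keyLowE, keyLow, Expr.eval]
@[simp] theorem evalP_frameE (D : Expr) (v : Expr × Expr) :
    evalP s (frameE D v) = frame (D.eval s) (evalP s v) := by
  refine Prod.ext ?_ ?_
  · change (iteE D (supE v) v.1 D).eval s = _
    rw [eval_iteE, eval_supE, frame]
    split_ifs <;> rfl
  · change (iteE D (supE v) v.2 (.const 0)).eval s = _
    rw [eval_iteE, eval_supE, frame]
    split_ifs <;> simp [Expr.eval, evalP]
@[simp] theorem eval_gridXE (D : Expr) (z z' p : Expr × Expr) : (gridXE D z z' p).eval s =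
    gridX (D.eval s) (evalP s z) (evalP s z') (evalP s p) := by
  simp [gridXE, gridX, Expr.eval]
@[simp] theorem eval_gridYE (D : Expr) (z z' p : Expr × Expr) : (gridYE D z z' p).eval s =
    gridY (D.eval s) (evalP s z) (evalP s z') (evalP s p) := by
  simp [gridYE, gridY, Expr.eval]
end

/-! ### Specifications of the parts of the algorithm -/

/-- An input of `n` points with coordinates `P 0, …, P (n - 1)`, and a grid resolution `m` for which
the grids with `O(m ^ 2)` cells can be handled in time `O(n)`. -/
structure Input where
  P : ℕ → ℝ × ℝ
  n : ℕ
  m : ℕ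
  one_le_m : 1 ≤ m
  sq_le : m ^ 2 ≤ n

namespace Input
variable (I : Input)

theorem one_le_n : 1 ≤ I.n := (Nat.one_le_pow _ _ I.one_le_m).trans I.sq_le

/-- The set of the input points. -/
def S : Set (ℝ × ℝ) := {q | ∃ i < I.n, I.P i = q}
/-- The set of the input points with indices in `A`. -/
def Q (A : Finset ℕ) : Set (ℝ × ℝ) := {q | ∃ i ∈ A, I.P i = q}

theorem Q_mono {A B : Finset ℕ} (h : A ⊆ B) : I.Q A ⊆ I.Q B := fun _ ⟨i, hi, e⟩ => ⟨i, h hi, e⟩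

/-- The memory between the parts of the algorithm: array `2` marks the points in `A`. -/
structure Ready (s : State) (A : Finset ℕ) : Prop where
  reg0 : s.reg 0 = I.n
  reg6 : s.reg 6 = I.m
  arr0 : ∀ i, s.arr 0 i = (I.P i).1
  arr1 : ∀ i, s.arr 1 i = (I.P i).2
  sub : A ⊆ Finset.range I.n
  marks : ∀ i < I.n, s.arr 2 i = if i ∈ A then 1 else 0

/-- The input point whose index is stored in register `r`. -/
noncomputable def pt (s : State) (r : ℕ) : ℝ × ℝ := I.P ⌊s.reg r⌋₊

/-- In the state `s'` the coordinates of the points are in place and the registers from `6` on,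
which hold the resolution, the selected points and the grid width, are as in `s`. -/
structure View (s s' : State) : Prop where
  arr0 : ∀ i, s'.arr 0 i = (I.P i).1
  arr1 : ∀ i, s'.arr 1 i = (I.P i).2
  reg : ∀ r, 6 ≤ r → s'.reg r = s.reg r

variable {I}

theorem View.evalP_ptE {s s' : State} (h : I.View s s') (r : ℕ) : evalP s' (ptE r) = I.pt s' r :=
  Prod.ext (h.arr0 _) (h.arr1 _)

theorem View.pt_eq {s s' : State} (h : I.View s s') {r : ℕ} (hr : 6 ≤ r) :
    I.pt s' r = I.pt s r := by
  unfold pt; rw [h.reg r hr]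

theorem View.evalP_ptE' {s s' : State} (h : I.View s s') {r : ℕ} (hr : 6 ≤ r) :
    evalP s' (ptE r) = I.pt s r := by
  rw [h.evalP_ptE, h.pt_eq hr]

theorem View.evalP_current {s s' : State} (h : I.View s s') {i : ℕ} (hi : s'.reg 2 = i) :
    evalP s' (ptE 2) = I.P i := by
  rw [h.evalP_ptE, pt, hi, Nat.floor_natCast]

theorem Ready.view {s : State} {A : Finset ℕ} (h : I.Ready s A) : I.View s s :=
  ⟨h.arr0, h.arr1, fun _ _ => rfl⟩

theorem View.of_frame {s s₁ s₂ : State} (h : I.View s s₁) (hf : Frame s₁ s₂) : I.View s s₂ :=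
  ⟨by rw [hf.arr0]; exact h.arr0, by rw [hf.arr1]; exact h.arr1,
    fun r hr => (hf.reg r (by omega)).trans (h.reg r hr)⟩

theorem View.setReg5 {s : State} {A : Finset ℕ} (h : I.Ready s A) (v : ℝ) :
    I.View s (s.setReg 5 v) :=
  ⟨h.arr0, h.arr1, fun r hr => by
    rw [State.setReg_reg, Function.update_of_ne (by omega)]⟩

variable (I)

/-- From the state `s` with marks `A`, the program `p` runs for time at most `c n`, marks at most `c
m ^ 2` further points and establishes `Post`. -/
def Achieves (c : ℕ) (p : Program) (s : State) (A : Finset ℕ)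
    (Post : State → Finset ℕ → Prop) : Prop :=
  ∃ t s' A', Runs p s t s' ∧ t ≤ c * I.n ∧ I.Ready s' A' ∧ A ⊆ A' ∧
    A'.card ≤ A.card + c * I.m ^ 2 ∧ Post s' A'

variable {I}

theorem Achieves.seq {c c' : ℕ} {p q : Program} {s : State} {A : Finset ℕ}
    {Mid Post : State → Finset ℕ → Prop} (h : I.Achieves c p s A Mid)
    (h' : ∀ s₁ A₁, I.Ready s₁ A₁ → A ⊆ A₁ → Mid s₁ A₁ → I.Achieves c' q s₁ A₁ Post) :
    I.Achieves (c + c') (.seq p q) s A Post := by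
  obtain ⟨t, s₁, A₁, hr, ht, hs, hA, hc, hm⟩ := h
  obtain ⟨t', s₂, A₂, hr', ht', hs', hA', hc', hp⟩ := h' s₁ A₁ hs hA hm
  refine ⟨_, s₂, A₂, .seq hr hr', ?_, hs', hA.trans hA', ?_, hp⟩
  · rw [add_mul]; omega
  · rw [add_mul]; omega

theorem Achieves.mono {c : ℕ} {p : Program} {s : State} {A : Finset ℕ}
    {Mid Post : State → Finset ℕ → Prop} (h : I.Achieves c p s A Mid)
    (h' : ∀ s₁ A₁, I.Ready s₁ A₁ → A ⊆ A₁ → Mid s₁ A₁ → Post s₁ A₁) :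
    I.Achieves c p s A Post := by
  obtain ⟨t, s₁, A₁, hr, ht, hs, hA, hc, hm⟩ := h
  exact ⟨t, s₁, A₁, hr, ht, hs, hA, hc, h' s₁ A₁ hs hA hm⟩

theorem achieves_set {s : State} {A : Finset ℕ} (h : I.Ready s A) {r : ℕ} (hr : 7 ≤ r) (e : Expr) :
    I.Achieves (e.cost + 1) (.set r e) s A fun s' A' => s' = s.setReg r (e.eval s) ∧ A' = A := by
  refine ⟨_, _, A, .set s r e, ?_, ⟨?_, ?_, h.arr0, h.arr1, h.sub, h.marks⟩, subset_rfl, by omega,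
    rfl, rfl⟩
  · exact Nat.le_mul_of_pos_right _ I.one_le_n
  · rw [State.setReg_reg, Function.update_of_ne (by omega)]; exact h.reg0
  · rw [State.setReg_reg, Function.update_of_ne (by omega)]; exact h.reg6

/-- The grids below have `(80 m + 1) ^ 2 ≤ 6561 m ^ 2` cells, which is the bound for the number of
buckets here; it is at most `6561 n`, so that the loops over the buckets take linear time. -/
theorem achieves_bucketMax {s : State} {A : Finset ℕ} (h : I.Ready s A) {incl : Test}
    {cell key Ne : Expr} {N : ℕ} (hNe : Ne.eval s = N) (hN : N ≤ 6561 * I.m ^ 2)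
    {J : ℕ → Prop} {cellf : ℕ → ℕ} {keyf : ℕ → ℝ}
    (hJ : ∀ s', I.View s s' → ∀ i < I.n, s'.reg 2 = i → (incl.Holds s' ↔ J i))
    (hcell : ∀ s', I.View s s' → ∀ i < I.n, s'.reg 2 = i → J i →
      cell.eval s' = cellf i)
    (hkey : ∀ s', I.View s s' → ∀ i < I.n, s'.reg 2 = i → J i → key.eval s' = keyf i)
    (hcellN : ∀ i < I.n, J i → cellf i < N) :
    I.Achieves (Ne.cost + 2 * (incl.cost + cell.cost + key.cost) + 500000)
      (.seq (.set 5 Ne) (bucketMax incl cell key)) s A fun s' A' =>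
        (∀ r, 6 ≤ r → s'.reg r = s.reg r) ∧
        ∀ i < I.n, J i → ∃ j ∈ A', BestIn I.n J cellf keyf (cellf i) j ∧
          s'.arr 3 (cellf i) = j := by
  have hv := View.setReg5 h (Ne.eval s)
  obtain ⟨t, s', hrun, ht, hf, F, hF, hFc, hmark, hbest⟩ :=
    halts_bucketMax (s := s.setReg 5 (Ne.eval s)) (incl := incl) (cell := cell) (key := key)
    (n := I.n) (N := N) (I := J) (cellf := cellf) (keyf := keyf)
    (by simpa using h.reg0) (by simpa using hNe)
    (fun s' hs' => hJ s' (hv.of_frame hs')) (fun s' hs' => hcell s' (hv.of_frame hs'))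
    (fun s' hs' => hkey s' (hv.of_frame hs'))
  have hv' := hv.of_frame hf
  refine ⟨_, s', A ∪ F, .seq (.set _ _ _) hrun, ?_, ⟨?_, ?_, hv'.arr0, hv'.arr1,
    Finset.union_subset h.sub hF, fun i hi => ?_⟩, Finset.subset_union_left, ?_, hv'.reg, ?_⟩
  · have h1 := I.one_le_n
    have h2 := I.sq_le
    nlinarith [Nat.mul_le_mul_left (incl.cost + cell.cost + key.cost) h1,
      Nat.mul_le_mul_left Ne.cost h1]
  · rw [hf.reg 0 (by omega)]; simpa using h.reg0
  · rw [hv'.reg 6 le_rfl]; exact h.reg6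
  · rw [hmark i]
    have := h.marks i hi
    simp only [State.setReg_arr, Finset.mem_union, this]
    by_cases h1 : i ∈ F <;> simp [h1]
  · refine (Finset.card_union_le _ _).trans (by nlinarith)
  · intro i hi hJi
    rcases hbest _ (hcellN i hi hJi) with h1 | ⟨j, hj, hb⟩
    · exact absurd rfl (h1 i hi hJi)
    · exact ⟨j, Finset.mem_union_right _ hj, hb.1, hb.2.1⟩

/-- Select a point with the largest key: store its index in register `r` and mark it. -/
def selectProg (r : ℕ) (key : Expr) : Program :=
  .seq (.seq (.set 5 (.const 1)) (bucketMax (.le (.const 0) (.const 0)) (.const 0) key))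
    (.set r (.read 3 (.const 0)))

/-- The indices stored in the registers `7, …, r - 1` are the same. -/
def Keeps (r : ℕ) (s s' : State) : Prop := ∀ r', 7 ≤ r' → r' < r → s'.reg r' = s.reg r'

theorem Keeps.pt {r : ℕ} {s s' : State} (h : Keeps r s s') {r' : ℕ} (h1 : 7 ≤ r') (h2 : r' < r) :
    I.pt s' r' = I.pt s r' := by
  unfold Input.pt; rw [h r' h1 h2]

theorem Keeps.trans {r r' : ℕ} {s s₁ s₂ : State} (h : Keeps r s s₁) (h' : Keeps r' s₁ s₂)
    (hr : r ≤ r') : Keeps r s s₂ := fun k h1 h2 => (h' k h1 (by omega)).trans (h k h1 h2)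

theorem achieves_select (r : ℕ) (hr : 7 ≤ r) (key : Expr) : ∃ c, ∀ (I : Input) (s : State)
    (A : Finset ℕ) (keyf : ℝ × ℝ → ℝ), I.Ready s A →
    (∀ s', I.View s s' → ∀ i : ℕ, s'.reg 2 = i → key.eval s' = keyf (I.P i)) →
    I.Achieves c (selectProg r key) s A fun s' A' =>
      Keeps r s s' ∧ I.pt s' r ∈ I.Q A' ∧ IsMaxOn keyf I.S (I.pt s' r) := by
  refine ⟨_ + ((Expr.read 3 (.const 0)).cost + 1), fun I s A keyf h hkey =>
    Achieves.seq (achieves_bucketMax h (N := 1)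
    (J := fun _ => True) (cellf := fun _ => 0) (keyf := fun i => keyf (I.P i)) (by simp [Expr.eval])
    ?_ ?_ ?_ (fun s' hv i _ hi _ => hkey s' hv i hi) ?_) ?_⟩
  · have := Nat.one_le_pow 2 _ I.one_le_m
    omega
  · intro s' _ i _ _
    simp [Test.Holds, Expr.eval]
  · intro s' _ i _ _ _
    simp [Expr.eval]
  · simp
  rintro s₁ A₁ h₁ - ⟨hregs, hb⟩
  obtain ⟨j, hj, ⟨-, -, -, hmax⟩, h3⟩ := hb 0 I.one_le_n trivial
  refine (achieves_set h₁ hr _).mono ?_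
  rintro s₂ A₂ - - ⟨rfl, rfl⟩
  have e : I.pt (s₁.setReg r ((Expr.read 3 (.const 0)).eval s₁)) r = I.P j := by
    simp [Input.pt, Expr.eval, h3]
  refine ⟨fun r' h1 h2 => ?_, ?_, ?_⟩
  · rw [State.setReg_reg, Function.update_of_ne (by omega), hregs r' (by omega)]
  · rw [e]; exact ⟨j, hj, rfl⟩
  · rw [e]
    rintro _ ⟨k, hk, rfl⟩
    exact hmax k hk trivial rfl

end Input

/-! ### The algorithm -/

section Mono
variable {S Q Q' : Set (ℝ × ℝ)} {m : ℝ}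

theorem GridGood.mono {z z' : ℝ × ℝ} {D : ℝ} (h : GridGood S Q m z z' D) (hQ : Q ⊆ Q') :
    GridGood S Q' m z z' D := fun p hp hD => by
  obtain ⟨p₁, h₁, p₂, h₂, r⟩ := h p hp hD
  exact ⟨p₁, hQ h₁, p₂, hQ h₂, r⟩

theorem TupleGood.mono {z₁ z₂ z₃ z₄ : ℝ × ℝ} (h : TupleGood S Q m z₁ z₂ z₃ z₄) (hQ : Q ⊆ Q') :
    TupleGood S Q' m z₁ z₂ z₃ z₄ := by
  obtain ⟨p, hp, h1, h2, h3⟩ := h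
  exact ⟨p, hQ hp, h1, h2.mono hQ, h3.mono hQ⟩

theorem PairGood.mono {x y : ℝ × ℝ} (h : PairGood S Q m x y) (hQ : Q ⊆ Q') :
    PairGood S Q' m x y := by
  obtain ⟨c, hc, e, he, f, hf, h1, h2, h3, h4, h5, h6⟩ := h
  exact ⟨c, hQ hc, e, hQ he, f, hQ hf, h1, h2, h3, h4.mono hQ, h5.mono hQ, h6.mono hQ⟩

/-- One half of `GridGood`: for `σ = 1` the points of `Q` after the given one, for `σ = -1` those
before. -/
def HalfGood (S Q : Set (ℝ × ℝ)) (m σ : ℝ) (z z' : ℝ × ℝ) (D : ℝ) : Prop :=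
  ∀ p ∈ S, gauge z z' p ≤ D → ∃ p₁ ∈ Q, gauge z z' p₁ ≤ D ∧
    σ * gridX D z z' p ≤ σ * gridX D z z' p₁ ∧
    |gridX D z z' p - gridX D z z' p₁| ≤ 1 / m ∧ |gridY D z z' p - gridY D z z' p₁| ≤ 1 / m

theorem GridGood.of_half {z z' : ℝ × ℝ} {D : ℝ} (h : HalfGood S Q m 1 z z' D)
    (h' : HalfGood S Q' m (-1) z z' D) (hQ : Q ⊆ Q') : GridGood S Q' m z z' D := by
  intro p hp hD
  obtain ⟨p₂, b1, b2, b3, b4, b5⟩ := h p hp hD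
  obtain ⟨p₁, a1, a2, a3, a4, a5⟩ := h' p hp hD
  exact ⟨p₁, a1, p₂, hQ b1, a2, b2, by linarith, by linarith, a4, b4, a5, b5⟩

end Mono

theorem abs_sub_le_of_floor_eq {x y m : ℝ} (hm : 0 < m) (hx : |x| ≤ 40) (hy : |y| ≤ 40)
    (h : ⌊(x + 40) * m⌋₊ = ⌊(y + 40) * m⌋₊) : |x - y| ≤ 1 / m := by
  rw [abs_le] at hx hy
  have h1 := Nat.floor_le (mul_nonneg (by linarith : 0 ≤ x + 40) hm.le)
  have h2 := Nat.floor_le (mul_nonneg (by linarith : 0 ≤ y + 40) hm.le)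
  have h3 := Nat.lt_floor_add_one ((x + 40) * m)
  have h4 := Nat.lt_floor_add_one ((y + 40) * m)
  rw [h] at h1 h3
  have e : |x - y| * m = |(x - y) * m| := by rw [abs_mul, abs_of_pos hm]
  rw [le_div_iff₀ hm, e, abs_le]
  constructor <;> linarith

theorem floor_lt_of_abs_le {x : ℝ} {m : ℕ} (hx : |x| ≤ 40) :
    ⌊(x + 40) * m⌋₊ < 80 * m + 1 := by
  rw [abs_le] at hx
  have : ⌊(x + 40) * m⌋₊ ≤ ⌊((80 * m : ℕ) : ℝ)⌋₊ := by
    apply Nat.floor_mono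
    push_cast
    gcongr
    linarith
  rw [Nat.floor_natCast] at this
  omega

theorem cast_natFloor_of_abs_le {x : ℝ} {m : ℕ} (hx : |x| ≤ 40) :
    ((⌊(x + 40) * m⌋ : ℤ) : ℝ) = (⌊(x + 40) * m⌋₊ : ℕ) := by
  rw [abs_le] at hx
  exact (natCast_floor_eq_intCast_floor (mul_nonneg (by linarith) (Nat.cast_nonneg m))).symm

theorem eq_of_mul_add_eq {k q r q' r' : ℕ} (hr : r < k) (hr' : r' < k)
    (h : q * k + r = q' * k + r') : q = q' ∧ r = r' := by
  have hk : 0 < k := by omega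
  have h1 := congrArg (· / k) h
  have h2 := congrArg (· % k) h
  simp only [mul_comm _ k, Nat.mul_add_div hk, Nat.div_eq_of_lt hr, Nat.div_eq_of_lt hr',
    Nat.mul_add_mod, Nat.mod_eq_of_lt hr, Nat.mod_eq_of_lt hr', add_zero] at h1 h2
  exact ⟨h1, h2⟩

namespace Input
variable {I : Input}

/-- The number of the cell of a point in the grid of width `D` on `[z, z']`. The shift by `40` makes
both grid coordinates nonnegative, and `80 m + 1` is the number of cells in a row. -/
def cellE (D : Expr) (z z' p : Expr × Expr) : Expr :=
  .add (.mul (.floor (.mul (.add (gridXE D z z' p) (.const 40)) (.reg 6)))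
      (.add (.mul (.const 80) (.reg 6)) (.const 1)))
    (.floor (.mul (.add (gridYE D z z' p) (.const 40)) (.reg 6)))

/-- In each cell of the grid on the segment between the points `a`, `b`, mark the last point (`σ =
1`) or the first one (`σ = -1`). Register `15` holds the width of the grid. -/
def halfProg (a b : ℕ) (σ : ℚ) : Program :=
  .seq (.set 5 (.mul (.add (.mul (.const 80) (.reg 6)) (.const 1))
      (.add (.mul (.const 80) (.reg 6)) (.const 1))))
    (bucketMax (.le (gaugeE (ptE a) (ptE b) (ptE 2)) (.reg 15))
      (cellE (.reg 15) (ptE a) (ptE b) (ptE 2))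
      (.mul (.const σ) (gridXE (.reg 15) (ptE a) (ptE b) (ptE 2))))

theorem achieves_half (a b : ℕ) (ha : 7 ≤ a) (hb : 7 ≤ b) (σ : ℚ) : ∃ c, ∀ (I : Input) (s : State)
    (A : Finset ℕ), I.Ready s A → I.Achieves c (halfProg a b σ) s A fun s' A' =>
      (∀ r, 6 ≤ r → s'.reg r = s.reg r) ∧
        HalfGood I.S (I.Q A') I.m σ (I.pt s a) (I.pt s b) (s.reg 15) := by
  refine ⟨_, fun I s A h => (achieves_bucketMax h (N := (80 * I.m + 1) * (80 * I.m + 1))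
    (J := fun i => gauge (I.pt s a) (I.pt s b) (I.P i) ≤ s.reg 15)
    (cellf := fun i => ⌊(gridX (s.reg 15) (I.pt s a) (I.pt s b) (I.P i) + 40) * I.m⌋₊ *
      (80 * I.m + 1) + ⌊(gridY (s.reg 15) (I.pt s a) (I.pt s b) (I.P i) + 40) * I.m⌋₊)
    (keyf := fun i => σ * gridX (s.reg 15) (I.pt s a) (I.pt s b) (I.P i))
    ?_ ?_ ?_ ?_ ?_ ?_).mono ?_⟩
  · simp [Expr.eval, h.reg6]
  · nlinarith [I.one_le_m]
  · intro s' hv i _ hi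
    simp [Test.Holds, Expr.eval, hv.evalP_ptE' (show 6 ≤ a by omega),
      hv.evalP_ptE' (show 6 ≤ b by omega), hv.evalP_current hi, hv.reg 15]
  · intro s' hv i _ hi hJ
    obtain ⟨hX, hY⟩ := abs_grid_le hJ
    simp [cellE, Expr.eval, hv.evalP_ptE' (show 6 ≤ a by omega),
      hv.evalP_ptE' (show 6 ≤ b by omega), hv.evalP_current hi, hv.reg 15, hv.reg 6, h.reg6,
      cast_natFloor_of_abs_le hX, cast_natFloor_of_abs_le hY]
  · intro s' hv i _ hi _
    simp [Expr.eval, hv.evalP_ptE' (show 6 ≤ a by omega),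
      hv.evalP_ptE' (show 6 ≤ b by omega), hv.evalP_current hi, hv.reg 15]
  · intro i _ hJ
    obtain ⟨hX, hY⟩ := abs_grid_le hJ
    have h1 := floor_lt_of_abs_le (m := I.m) hX
    have h2 := floor_lt_of_abs_le (m := I.m) hY
    nlinarith
  · rintro s' A' - - ⟨hr, hbest⟩
    refine ⟨hr, ?_⟩
    rintro _ ⟨i, hi, rfl⟩ hD
    obtain ⟨j, hj, ⟨-, hJ, hcell, hmax⟩, -⟩ := hbest i hi hD
    obtain ⟨hX, hY⟩ := abs_grid_le hD
    obtain ⟨hX', hY'⟩ := abs_grid_le hJ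
    obtain ⟨e1, e2⟩ := eq_of_mul_add_eq (floor_lt_of_abs_le hY') (floor_lt_of_abs_le hY) hcell
    have hm : (0 : ℝ) < I.m := by exact_mod_cast I.one_le_m
    exact ⟨_, ⟨j, hj, rfl⟩, hJ, hmax i hi hD rfl, abs_sub_le_of_floor_eq hm hX hX' e1.symm,
      abs_sub_le_of_floor_eq hm hY hY' e2.symm⟩

/-- Mark the first and the last point of each cell. -/
def gridProg (a b : ℕ) : Program := .seq (halfProg a b 1) (halfProg a b (-1))

theorem achieves_grid (a b : ℕ) (ha : 7 ≤ a) (hb : 7 ≤ b) : ∃ c, ∀ (I : Input) (s : State)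
    (A : Finset ℕ), I.Ready s A → I.Achieves c (gridProg a b) s A fun s' A' =>
      (∀ r, 6 ≤ r → s'.reg r = s.reg r) ∧
        GridGood I.S (I.Q A') I.m (I.pt s a) (I.pt s b) (s.reg 15) := by
  obtain ⟨c₁, h₁⟩ := achieves_half a b ha hb 1
  obtain ⟨c₂, h₂⟩ := achieves_half a b ha hb (-1)
  refine ⟨c₁ + c₂, fun I s A h => (h₁ I s A h).seq fun s₁ A₁ hs₁ _ ⟨hr, hg⟩ =>
    (h₂ I s₁ A₁ hs₁).mono ?_⟩
  rintro s₂ A₂ - hA ⟨hr', hg'⟩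
  refine ⟨fun r h6 => (hr' r h6).trans (hr r h6), ?_⟩
  simp only [Input.pt, hr a (by omega), hr b (by omega), hr 15 (by omega)] at hg'
  exact GridGood.of_half (by simpa [Input.pt] using hg) (by simpa [Input.pt] using hg')
    (I.Q_mono hA)

/-- Mark a point farthest from the segments `[a, b]`, `[c, d]`, take its distance as grid width and
mark points in the grids on the two segments. -/
def tupleProg (a b c d : ℕ) : Program :=
  .seq (selectProg 16 (pairGaugeE (ptE a) (ptE b) (ptE c) (ptE d) (ptE 2)))
    (.seq (.set 15 (pairGaugeE (ptE a) (ptE b) (ptE c) (ptE d) (ptE 16)))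
      (.seq (gridProg a b) (gridProg c d)))

theorem achieves_tuple {a b c d : ℕ} (ha : 7 ≤ a ∧ a < 15) (hb : 7 ≤ b ∧ b < 15)
    (hc : 7 ≤ c ∧ c < 15) (hd : 7 ≤ d ∧ d < 15) : ∃ k, ∀ (I : Input) (s : State)
    (A : Finset ℕ), I.Ready s A → I.Achieves k (tupleProg a b c d) s A fun s' A' =>
      Keeps 15 s s' ∧
        TupleGood I.S (I.Q A') I.m (I.pt s a) (I.pt s b) (I.pt s c) (I.pt s d) := by
  obtain ⟨k₁, h₁⟩ := achieves_select 16 (by omega)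
    (pairGaugeE (ptE a) (ptE b) (ptE c) (ptE d) (ptE 2))
  obtain ⟨k₃, h₃⟩ := achieves_grid a b (by omega) (by omega)
  obtain ⟨k₄, h₄⟩ := achieves_grid c d (by omega) (by omega)
  refine ⟨_, fun I s A h => (h₁ I s A (pairGauge (I.pt s a) (I.pt s b) (I.pt s c) (I.pt s d)) h
    fun s' hv i hi => ?_).seq fun s₁ A₁ hs₁ hA₁ ⟨k1, q1, m1⟩ =>
    (achieves_set hs₁ (by omega) _).seq fun s₂ A₂ hs₂ hA₂ ⟨e2, e2'⟩ =>
    (h₃ I s₂ A₂ hs₂).seq fun s₃ A₃ hs₃ hA₃ ⟨k3, g3⟩ => (h₄ I s₃ A₃ hs₃).mono ?_⟩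
  · simp [hv.evalP_ptE' (show 6 ≤ a by omega), hv.evalP_ptE' (show 6 ≤ b by omega),
      hv.evalP_ptE' (show 6 ≤ c by omega), hv.evalP_ptE' (show 6 ≤ d by omega),
      hv.evalP_current hi]
  rintro s₄ A₄ - hA₄ ⟨k4, g4⟩
  have hv := hs₁.view
  have p1 : ∀ r, 7 ≤ r ∧ r < 15 → I.pt s₁ r = I.pt s r := fun r hr => k1.pt hr.1 (by omega)
  have p2 : ∀ r, r ≠ 15 → s₂.reg r = s₁.reg r := fun r hr => by
    rw [e2, State.setReg_reg, Function.update_of_ne hr]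
  have p2' : ∀ r, 7 ≤ r ∧ r < 15 → I.pt s₂ r = I.pt s r := fun r hr => by
    rw [← p1 r hr, Input.pt, p2 r (by omega), Input.pt]
  have p3 : ∀ r, 7 ≤ r ∧ r < 15 → I.pt s₃ r = I.pt s r := fun r hr => by
    rw [← p2' r hr, Input.pt, k3 r (by omega), Input.pt]
  have hD : s₂.reg 15 =
      pairGauge (I.pt s a) (I.pt s b) (I.pt s c) (I.pt s d) (I.pt s₁ 16) := by
    rw [e2]
    simp [hv.evalP_ptE, p1 a ha, p1 b hb, p1 c hc, p1 d hd]
  rw [hD, p2' a ha, p2' b hb] at g3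
  rw [k3 15 (by omega), hD, p3 c hc, p3 d hd] at g4
  refine ⟨fun r h7 h15 => ?_, I.pt s₁ 16, ?_, m1, g3.mono (I.Q_mono hA₄), g4⟩
  · rw [k4 r (by omega), k3 r (by omega), p2 r (by omega), k1 r h7 (by omega)]
  · exact I.Q_mono (e2' ▸ hA₃.trans hA₄) q1

/-- Establish `PairGood` for the points in the registers `x`, `y`; registers `12`, `13`, `14` are
for the points `c`, `e`, `f`. -/
def pairProg (x y : ℕ) : Program :=
  .seq (selectProg 12 (heightE (ptE x) (ptE y) (ptE 2)))
  (.seq (selectProg 13 (keyHighE (ptE x) (ptE y) (ptE 12) (ptE 2)))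
  (.seq (selectProg 14 (keyLowE (ptE x) (ptE y) (ptE 12) (ptE 2)))
  (.seq (tupleProg x y x y) (.seq (tupleProg x y 12 13) (tupleProg x y 12 14)))))

theorem achieves_pair {x y : ℕ} (hx : 7 ≤ x ∧ x < 12) (hy : 7 ≤ y ∧ y < 12) :
    ∃ k, ∀ (I : Input) (s : State) (A : Finset ℕ), I.Ready s A →
      I.Achieves k (pairProg x y) s A fun s' A' =>
        Keeps 12 s s' ∧ PairGood I.S (I.Q A') I.m (I.pt s x) (I.pt s y) := by
  obtain ⟨k₁, h₁⟩ := achieves_select 12 (by omega) (heightE (ptE x) (ptE y) (ptE 2))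
  obtain ⟨k₂, h₂⟩ := achieves_select 13 (by omega) (keyHighE (ptE x) (ptE y) (ptE 12) (ptE 2))
  obtain ⟨k₃, h₃⟩ := achieves_select 14 (by omega) (keyLowE (ptE x) (ptE y) (ptE 12) (ptE 2))
  obtain ⟨k₄, h₄⟩ := achieves_tuple (a := x) (b := y) (c := x) (d := y) (by omega) (by omega)
    (by omega) (by omega)
  obtain ⟨k₅, h₅⟩ := achieves_tuple (a := x) (b := y) (c := 12) (d := 13) (by omega) (by omega)
    (by omega) (by omega)
  obtain ⟨k₆, h₆⟩ := achieves_tuple (a := x) (b := y) (c := 12) (d := 14) (by omega) (by omega)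
    (by omega) (by omega)
  refine ⟨_, fun I s A h => (h₁ I s A (height (I.pt s x) (I.pt s y)) h
      fun s' hv i hi => ?_).seq fun s₁ A₁ hs₁ _ ⟨r1, q1, m1⟩ =>
    (h₂ I s₁ A₁ (keyHigh (I.pt s₁ x) (I.pt s₁ y) (I.pt s₁ 12)) hs₁
      fun s' hv i hi => ?_).seq fun s₂ A₂ hs₂ hA₂ ⟨r2, q2, m2⟩ =>
    (h₃ I s₂ A₂ (keyLow (I.pt s₂ x) (I.pt s₂ y) (I.pt s₂ 12)) hs₂
      fun s' hv i hi => ?_).seq fun s₃ A₃ hs₃ hA₃ ⟨r3, q3, m3⟩ =>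
    (h₄ I s₃ A₃ hs₃).seq fun s₄ A₄ hs₄ hA₄ ⟨r4, t4⟩ =>
    (h₅ I s₄ A₄ hs₄).seq fun s₅ A₅ hs₅ hA₅ ⟨r5, t5⟩ =>
    (h₆ I s₅ A₅ hs₅).mono ?_⟩
  · simp [hv.evalP_ptE' (show 6 ≤ x by omega), hv.evalP_ptE' (show 6 ≤ y by omega),
      hv.evalP_current hi]
  · simp [hv.evalP_ptE' (show 6 ≤ x by omega), hv.evalP_ptE' (show 6 ≤ y by omega),
      hv.evalP_ptE' (show 6 ≤ 12 by omega), hv.evalP_current hi]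
  · simp [hv.evalP_ptE' (show 6 ≤ x by omega), hv.evalP_ptE' (show 6 ≤ y by omega),
      hv.evalP_ptE' (show 6 ≤ 12 by omega), hv.evalP_current hi]
  rintro s₆ A₆ - hA₆ ⟨r6, t6⟩
  have r34 := r3.trans (r4.trans r5 le_rfl) (by omega)
  have r24 := r2.trans r34 (by omega)
  have r14 := r1.trans r24 (by omega)
  rw [r5.pt (by omega) (by omega), r5.pt (by omega) (by omega), r5.pt (by omega) (by omega),
    r5.pt (by omega) (by omega)] at t6
  rw [r4.pt (by omega) (by omega), r4.pt (by omega) (by omega), r4.pt (by omega) (by omega),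
    r4.pt (by omega) (by omega)] at t5 t6
  have ex : I.pt s₃ x = I.pt s x := (r1.trans (r2.trans r3 (by omega)) (by omega)).pt hx.1 hx.2
  have ey : I.pt s₃ y = I.pt s y := (r1.trans (r2.trans r3 (by omega)) (by omega)).pt hy.1 hy.2
  have e12 : I.pt s₃ 12 = I.pt s₁ 12 := (r2.trans r3 (by omega)).pt (by omega) (by omega)
  have e13 : I.pt s₃ 13 = I.pt s₂ 13 := r3.pt (by omega) (by omega)
  rw [ex, ey] at t4 t5 t6
  rw [e12] at t5 t6
  rw [e13] at t5
  rw [r1.pt hx.1 hx.2, r1.pt hy.1 hy.2] at m2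
  rw [r2.pt (by omega) (by omega), r2.pt (by omega) (by omega), r2.pt (by omega) (by omega),
    r1.pt hx.1 hx.2, r1.pt hy.1 hy.2] at m3
  have m5 := hA₅.trans hA₆
  have m36 := hA₃.trans (hA₄.trans m5)
  exact ⟨r14.trans r6 (by omega), _, I.Q_mono (hA₂.trans m36) q1, _, I.Q_mono m36 q2, _,
    I.Q_mono (hA₄.trans m5) q3, m1, m2, m3, t4.mono (I.Q_mono m5), t5.mono (I.Q_mono hA₆), t6⟩

/-- Run `pairProg` for all pairs of registers in a list. -/
def pairsProg (L : List (ℕ × ℕ)) : Program :=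
  L.foldr (fun xy q => .seq (pairProg xy.1 xy.2) q) .skip

theorem achieves_pairs (L : List (ℕ × ℕ))
    (hL : ∀ xy ∈ L, (7 ≤ xy.1 ∧ xy.1 < 12) ∧ (7 ≤ xy.2 ∧ xy.2 < 12)) :
    ∃ k, ∀ (I : Input) (s : State) (A : Finset ℕ), I.Ready s A →
      I.Achieves k (pairsProg L) s A fun _ A' =>
        ∀ xy ∈ L, PairGood I.S (I.Q A') I.m (I.pt s xy.1) (I.pt s xy.2) := by
  induction L with
  | nil => exact ⟨1, fun I s A h => ⟨_, s, A, .skip s, by simpa using I.one_le_n, h, subset_rfl,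
      by omega, by simp⟩⟩
  | cons xy L ih =>
    obtain ⟨hx, hy⟩ := hL xy (by simp)
    obtain ⟨k₁, h₁⟩ := achieves_pair hx hy
    obtain ⟨k₂, h₂⟩ := ih fun xy h => hL xy (by simp [h])
    refine ⟨k₁ + k₂, fun I s A h => (h₁ I s A h).seq fun s₁ A₁ hs₁ _ ⟨r1, g1⟩ =>
      (h₂ I s₁ A₁ hs₁).mono ?_⟩
    intro s₂ A₂ _ hA g2 xy' hxy
    rcases List.mem_cons.1 hxy with rfl | hxy'
    · exact g1.mono (I.Q_mono hA)
    · obtain ⟨hx', hy'⟩ := hL xy' hxy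
      have := g2 xy' hxy'
      rwa [r1.pt hx'.1 hx'.2, r1.pt hy'.1 hy'.2] at this

/-- All pairs of the registers for the five points of `SeedGood`. -/
def seedPairs : List (ℕ × ℕ) := List.product [7, 8, 9, 10, 11] [7, 8, 9, 10, 11]

/-- Establish `SeedGood`. The key `0` selects an arbitrary first point. -/
def seedProg : Program :=
  .seq (selectProg 7 (.const 0))
  (.seq (selectProg 8 (supE (subE (ptE 2) (ptE 7))))
  (.seq (selectProg 9 (keyNearE (ptE 7) (ptE 8) (ptE 2)))
  (.seq (selectProg 10 (keyNearE (ptE 8) (ptE 7) (ptE 2)))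
  (.seq (selectProg 11 (pairGaugeE (ptE 7) (ptE 9) (ptE 8) (ptE 10) (ptE 2)))
  (.seq (tupleProg 7 9 8 10) (pairsProg seedPairs))))))

theorem achieves_seed : ∃ k, ∀ (I : Input) (s : State) (A : Finset ℕ), I.Ready s A →
    I.Achieves k seedProg s A fun _ A' => SeedGood I.S (I.Q A') I.m := by
  obtain ⟨k₁, h₁⟩ := achieves_select 7 (by omega) (.const 0)
  obtain ⟨k₂, h₂⟩ := achieves_select 8 (by omega) (supE (subE (ptE 2) (ptE 7)))
  obtain ⟨k₃, h₃⟩ := achieves_select 9 (by omega) (keyNearE (ptE 7) (ptE 8) (ptE 2))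
  obtain ⟨k₄, h₄⟩ := achieves_select 10 (by omega) (keyNearE (ptE 8) (ptE 7) (ptE 2))
  obtain ⟨k₅, h₅⟩ := achieves_select 11 (by omega)
    (pairGaugeE (ptE 7) (ptE 9) (ptE 8) (ptE 10) (ptE 2))
  obtain ⟨k₆, h₆⟩ := achieves_tuple (a := 7) (b := 9) (c := 8) (d := 10) (by omega) (by omega)
    (by omega) (by omega)
  have hmem : ∀ x y : ℕ, (x, y) ∈ seedPairs ↔ (7 ≤ x ∧ x < 12) ∧ (7 ≤ y ∧ y < 12) := by
    intro x y
    simp only [seedPairs, List.pair_mem_product, List.mem_cons, List.not_mem_nil, or_false]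
    omega
  obtain ⟨k₇, h₇⟩ := achieves_pairs seedPairs fun xy h => (hmem xy.1 xy.2).1 h
  refine ⟨_, fun I s A h => (h₁ I s A (fun _ => 0) h
      fun s' hv i hi => ?_).seq fun s₁ A₁ hs₁ _ ⟨r1, q1, m1⟩ =>
    (h₂ I s₁ A₁ (fun q => supNorm (q - I.pt s₁ 7)) hs₁
      fun s' hv i hi => ?_).seq fun s₂ A₂ hs₂ hA₂ ⟨r2, q2, m2⟩ =>
    (h₃ I s₂ A₂ (keyNear (I.pt s₂ 7) (I.pt s₂ 8)) hs₂
      fun s' hv i hi => ?_).seq fun s₃ A₃ hs₃ hA₃ ⟨r3, q3, m3⟩ =>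
    (h₄ I s₃ A₃ (keyNear (I.pt s₃ 8) (I.pt s₃ 7)) hs₃
      fun s' hv i hi => ?_).seq fun s₄ A₄ hs₄ hA₄ ⟨r4, q4, m4⟩ =>
    (h₅ I s₄ A₄ (pairGauge (I.pt s₄ 7) (I.pt s₄ 9) (I.pt s₄ 8) (I.pt s₄ 10)) hs₄
      fun s' hv i hi => ?_).seq fun s₅ A₅ hs₅ hA₅ ⟨r5, q5, m5⟩ =>
    (h₆ I s₅ A₅ hs₅).seq fun s₆ A₆ hs₆ hA₆ ⟨r6, t6⟩ =>
    (h₇ I s₆ A₆ hs₆).mono ?_⟩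
  · simp [Expr.eval]
  · simp [hv.evalP_ptE' (show 6 ≤ 7 by omega), hv.evalP_current hi]
  · simp [hv.evalP_ptE' (show 6 ≤ 7 by omega), hv.evalP_ptE' (show 6 ≤ 8 by omega),
      hv.evalP_current hi]
  · simp [hv.evalP_ptE' (show 6 ≤ 7 by omega), hv.evalP_ptE' (show 6 ≤ 8 by omega),
      hv.evalP_current hi]
  · simp [hv.evalP_ptE' (show 6 ≤ 7 by omega), hv.evalP_ptE' (show 6 ≤ 8 by omega),
      hv.evalP_ptE' (show 6 ≤ 9 by omega), hv.evalP_ptE' (show 6 ≤ 10 by omega),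
      hv.evalP_current hi]
  rintro s₇ A₇ - hA₇ g7
  have r45 := r4.trans r5 (by omega)
  have r35 := r3.trans r45 (by omega)
  have r25 := r2.trans r35 (by omega)
  have e7 : I.pt s₅ 7 = I.pt s₁ 7 := r25.pt (by omega) (by omega)
  have e8 : I.pt s₅ 8 = I.pt s₂ 8 := r35.pt (by omega) (by omega)
  have e9 : I.pt s₅ 9 = I.pt s₃ 9 := r45.pt (by omega) (by omega)
  have e10 : I.pt s₅ 10 = I.pt s₄ 10 := r5.pt (by omega) (by omega)
  rw [← e8, ← e7] at m2
  rw [← e9, ← r35.pt (show 7 ≤ 7 by omega) (by omega), ← e8] at m3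
  rw [← e10, ← r45.pt (show 7 ≤ 7 by omega) (by omega),
    ← r45.pt (show 7 ≤ 8 by omega) (by omega)] at m4
  rw [← r5.pt (show 7 ≤ 7 by omega) (by omega), ← r5.pt (show 7 ≤ 8 by omega) (by omega),
    ← r5.pt (show 7 ≤ 9 by omega) (by omega), ← e10] at m5
  rw [← e7] at q1
  rw [← e8] at q2
  rw [← e9] at q3
  rw [← e10] at q4
  have a57 := hA₆.trans hA₇
  have a47 := hA₅.trans a57
  have a37 := hA₄.trans a47
  have a27 := hA₃.trans a37
  have g7' : ∀ x y, 7 ≤ x ∧ x < 12 → 7 ≤ y ∧ y < 12 →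
      PairGood I.S (I.Q A₇) I.m (I.pt s₅ x) (I.pt s₅ y) := fun x y hx hy => by
    have := g7 (x, y) ((hmem x y).2 ⟨hx, hy⟩)
    rwa [r6.pt hx.1 (by omega), r6.pt hy.1 (by omega)] at this
  have hset : ∀ x ∈ ({I.pt s₅ 7, I.pt s₅ 8, I.pt s₅ 9, I.pt s₅ 10, I.pt s₅ 11} : Set (ℝ × ℝ)),
      ∃ r, (7 ≤ r ∧ r < 12) ∧ x = I.pt s₅ r := by
    rintro x (rfl | rfl | rfl | rfl | rfl)
    exacts [⟨7, by omega, rfl⟩, ⟨8, by omega, rfl⟩, ⟨9, by omega, rfl⟩, ⟨10, by omega, rfl⟩,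
      ⟨11, by omega, rfl⟩]
  refine ⟨_, I.Q_mono (hA₂.trans a27) q1, _, I.Q_mono a27 q2, _, I.Q_mono a37 q3, _,
    I.Q_mono a47 q4, _, I.Q_mono a57 q5, m2, m3, m4, m5, t6.mono (I.Q_mono hA₇), ?_⟩
  intro x hx y hy
  obtain ⟨r, hr, rfl⟩ := hset x hx
  obtain ⟨r', hr', rfl⟩ := hset y hy
  exact g7' r r' hr hr'

end Input

/-! ### Initialization and output -/

/-- Move the marked points to the front of arrays `0` and `1` and store their number in register
`0`. A point never moves to a larger index, so no point is overwritten before it has been read. -/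
def compactProg : Program :=
  .seq (.set 3 (.const 0))
  (.seq (forLoop (.reg 0) (.branch (.le (.const 1) (.read 2 (.reg 2)))
      (.seq (.write 0 (.reg 3) (.read 0 (.reg 2)))
        (.seq (.write 1 (.reg 3) (.read 1 (.reg 2))) (.set 3 (.add (.reg 3) (.const 1)))))
      .skip))
    (.set 0 (.reg 3)))

theorem halts_compact {s : State} {n : ℕ} {A : Finset ℕ} (hA : A ⊆ Finset.range n)
    (h0 : s.reg 0 = n) (hmark : ∀ i < n, s.arr 2 i = if i ∈ A then 1 else 0) :
    Halts compactProg s (40 * (n + 1)) fun s' =>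
      s'.reg 0 = A.card ∧ ∃ e : ℕ → ℕ, (Finset.range A.card).image e = A ∧
        ∀ j < A.card, s'.arr 0 j = s.arr 0 (e j) ∧ s'.arr 1 j = s.arr 1 (e j) := by
  have hloop := halts_forLoop (e := .reg 0) (N := n)
    (body := .branch (.le (.const 1) (.read 2 (.reg 2)))
      (.seq (.write 0 (.reg 3) (.read 0 (.reg 2)))
        (.seq (.write 1 (.reg 3) (.read 1 (.reg 2))) (.set 3 (.add (.reg 3) (.const 1)))))
      .skip)
    (I := fun i s' => s'.reg 0 = n ∧ s'.arr 2 = s.arr 2 ∧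
      (∀ j, i ≤ j → s'.arr 0 j = s.arr 0 j ∧ s'.arr 1 j = s.arr 1 j) ∧
      ∃ k ≤ i, (A.filter (· < i)).card = k ∧ s'.reg 3 = k ∧
      ∃ e : ℕ → ℕ, (Finset.range k).image e = A.filter (· < i) ∧
        ∀ j < k, s'.arr 0 j = s.arr 0 (e j) ∧ s'.arr 1 j = s.arr 1 (e j))
    (fun i s' v h => by simpa using h) (fun i s' h => by simpa [Expr.eval] using h.1)
    (fun i hi s' hr h => by
      obtain ⟨h0', h2, hrest, k, hki, hk, h3, e, he, hdata⟩ := h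
      have hr2 : s'.arr 2 i = if i ∈ A then 1 else 0 := by rw [h2, hmark i hi]
      have hrest' : ∀ (j : ℕ), i + 1 ≤ j → s'.arr 0 j = s.arr 0 j ∧ s'.arr 1 j = s.arr 1 j :=
        fun j hj => hrest j (by omega)
      refine does_branch (fun hb => ?_) (fun hb => ?_)
      · have hiA : i ∈ A := by
          by_contra hiA
          simp [Test.Holds, Expr.eval, hr, hr2, hiA] at hb
          norm_num at hb
        have hfil : A.filter (· < i + 1) = insert i (A.filter (· < i)) := by
          ext j
          simp only [Finset.mem_filter, Finset.mem_insert]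
          constructor
          · rintro ⟨h1, h2⟩
            rcases Nat.lt_succ_iff_lt_or_eq.1 h2 with h | h
            · exact Or.inr ⟨h1, h⟩
            · exact Or.inl h
          · rintro (rfl | ⟨h1, h2⟩)
            · exact ⟨hiA, by omega⟩
            · exact ⟨h1, by omega⟩
        refine does_seq (does_write (does_seq (does_write (does_set ?_))))
        refine ⟨by simpa using hr, by simpa using h0', by simpa using h2, fun j hj => ?_, k + 1,
          by omega, ?_, by simp [Expr.eval, h3], Function.update e k i, ?_, fun j hj => ?_⟩
        · have hjk : j ≠ k := by omega
          simpa [Expr.eval, h3, hjk] using hrest' j hj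
        · rw [hfil, Finset.card_insert_of_notMem (by simp), hk]
        · rw [hfil, Finset.range_add_one, Finset.image_insert, Function.update_self, ← he]
          congr 1
          refine Finset.image_congr fun j hj => ?_
          have : j < k := by simpa using hj
          exact Function.update_of_ne (by omega) _ _
        · rcases Nat.lt_succ_iff_lt_or_eq.1 hj with hj | rfl
          · have hjk : j ≠ k := by omega
            simpa [Expr.eval, h3, hjk] using hdata j hj
          · have := hrest i le_rfl
            simp [Expr.eval, h3, hr, this.1, this.2]
      · have hiA : i ∉ A := by
          intro hiA
          simp [Test.Holds, Expr.eval, hr, hr2, hiA] at hb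
        have hfil : A.filter (· < i + 1) = A.filter (· < i) := by
          refine Finset.filter_congr fun j hj => ?_
          have : j ≠ i := fun h => hiA (h ▸ hj)
          omega
        refine does_skip ⟨hr, h0', h2, hrest', k, by omega, by rw [hfil, hk], h3, e,
          by rw [hfil, he], hdata⟩)
    (s := s.setReg 3 ((Expr.const 0).eval s))
    ⟨by simpa using h0, rfl, fun j _ => ⟨rfl, rfl⟩, 0, le_rfl, by simp, by simp [Expr.eval], id,
      by simp, by simp⟩
  refine Halts.mono (Halts.seq (T := 2) ⟨_, _, .set _ _ _, by simp [Expr.cost],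
    Halts.seq (T' := 2) (hloop.mono le_rfl fun s₁ h => ?_)⟩) ?_ fun s' h => h
  · obtain ⟨-, -, -, k, -, hk, h3, e, he, hdata⟩ := h
    have hAn : A.filter (· < n) = A :=
      Finset.filter_true_of_mem fun j hj => Finset.mem_range.1 (hA hj)
    rw [hAn] at hk he
    subst hk
    exact ⟨_, _, .set _ _ _, by simp [Expr.cost], by simp [Expr.eval, h3], e, he, hdata⟩
  · simp only [Program.bound, Test.cost, Expr.cost]
    omega

/-- Remove all marks. -/
def initProg : Program := forLoop (.reg 0) (.write 2 (.reg 2) (.const 0))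

theorem halts_init {s : State} {n : ℕ} (h0 : s.reg 0 = n) :
    Halts initProg s (20 * (n + 1)) fun s' => Frame s s' ∧ ∀ i < n, s'.arr 2 i = 0 := by
  refine (halts_forLoop (N := n) (I := fun i s' => Frame s s' ∧ ∀ j < i, s'.arr 2 j = 0)
    (fun i s' v h => ⟨h.1.setReg (by omega) v, h.2⟩)
    (fun i s' h => by simpa [Expr.eval, h0] using h.1.reg 0 (by omega))
    (fun i _ s' hr h => does_write ⟨hr, h.1.setCell (by omega) _ _, fun j hj => ?_⟩)
    ⟨Frame.refl s, by simp⟩).mono ?_ fun _ h => h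
  · rcases Nat.lt_succ_iff_lt_or_eq.1 hj with hj | rfl
    · have hji : j ≠ i := by omega
      simpa [Expr.eval, hr, hji] using h.2 j hj
    · simp [Expr.eval, hr]
  · refine Nat.mul_le_mul_right _ ?_
    simp only [Program.bound, Expr.cost]
    omega

/-- The algorithm. The resolution is `m = ⌊240 / ε⌋ + 241`; if there are fewer than `m ^ 2 = O(max 1
ε⁻²)` points, then the input is its own certificate. -/
def certProg : Program :=
  .seq (.set 6 (.add (.floor (.div (.const 240) (.reg 1))) (.const 241)))
  (.branch (.le (.mul (.reg 6) (.reg 6)) (.reg 0))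
    (.seq initProg (.seq Input.seedProg compactProg)) .skip)

/-! ### From coordinates to slabs -/

/-- The coordinates of a point of the plane. -/
def toPair (p : Plane) : ℝ × ℝ := (p 0, p 1)

theorem inner_eq_dot (p q : Plane) : inner ℝ p q = dot (toPair p) (toPair q) := by
  simp [PiLp.inner_apply, Fin.sum_univ_two, dot, toPair, mul_comm]

/-- Two slabs of the same width in coordinates. -/
def pairStrips (σ₁ σ₂ : Slab) : TwoStrips where
  u := ![toPair σ₁.normal, toPair σ₂.normal]
  o := ![σ₁.offset, σ₂.offset]
  w := σ₁.width
  unit i := by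
    have h : ∀ σ : Slab, dot (toPair σ.normal) (toPair σ.normal) = 1 := fun σ => by
      rw [← inner_eq_dot, real_inner_self_eq_norm_sq, σ.norm_normal, one_pow]
    fin_cases i
    · exact h σ₁
    · exact h σ₂
  w_nonneg := σ₁.width_nonneg

theorem pairStrips_covers_iff {σ₁ σ₂ : Slab} {w : ℝ} {S : Set Plane} :
    (pairStrips σ₁ σ₂).Covers w (toPair '' S) ↔
      ∀ p ∈ S, |inner ℝ σ₁.normal p - σ₁.offset| ≤ w / 2 ∨
        |inner ℝ σ₂.normal p - σ₂.offset| ≤ w / 2 := by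
  simp [TwoStrips.Covers, Fin.exists_fin_two, pairStrips, InStrip, inner_eq_dot]

theorem isCertificate_of_seed {ε m : ℝ} (hε : 0 < ε) (hm : 0 < m) (hmε : 240 / ε ≤ m)
    {S Q : Finset Plane} (hQS : Q ⊆ S)
    (h : SeedGood (toPair '' (S : Set Plane)) (toPair '' (Q : Set Plane)) m) :
    IsCertificate ε hε S Q := by
  refine ⟨hQS, fun σ₁ σ₂ hw hcov p hp => ?_⟩
  have h1 : (pairStrips σ₁ σ₂).Covers (pairStrips σ₁ σ₂).w (toPair '' (Q : Set Plane)) := by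
    rw [pairStrips_covers_iff]
    intro q hq
    have := hcov hq
    simp only [Set.mem_union, Slab.carrier, Set.mem_ofPred_eq] at this
    rw [← hw] at this
    exact this
  have h2 := covers_of_seed _ hε hm hmε (Set.image_mono (by exact_mod_cast hQS)) h h1
  rw [pairStrips_covers_iff] at h2
  have := h2 p hp
  simp only [Set.mem_union, Slab.carrier, Slab.expansion, Set.mem_ofPred_eq]
  rw [← hw]
  exact this

theorem isCertificate_self {ε : ℝ} (hε : 0 < ε) (S : Finset Plane) : IsCertificate ε hε S S := by
  refine ⟨subset_rfl, fun σ₁ σ₂ _ hcov p hp => ?_⟩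
  have h : ∀ σ : Slab, σ.carrier ⊆ (σ.expansion ε hε).carrier := fun σ q hq => by
    simp only [Slab.carrier, Slab.expansion, Set.mem_ofPred_eq] at hq ⊢
    have := mul_nonneg hε.le σ.width_nonneg
    linarith
  exact (hcov hp).imp (fun h' => h σ₁ h') (fun h' => h σ₂ h')

theorem exists_natFloor_add_sq_le : ∃ K : ℕ, 1 ≤ K ∧ ∀ ε : ℝ, 0 < ε →
    ((⌊240 / ε⌋₊ + 241 : ℕ) : ℝ) ^ 2 ≤ K * max 1 (1 / ε ^ 2) := by
  refine ⟨231361, by norm_num, fun ε hε => ?_⟩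
  have h1 : ((⌊240 / ε⌋₊ + 241 : ℕ) : ℝ) ≤ 481 * max 1 (1 / ε) := by
    push_cast
    have h2 := Nat.floor_le (by positivity : 0 ≤ 240 / ε)
    have h3 := le_max_left 1 (1 / ε)
    have h4 := le_max_right 1 (1 / ε)
    have : 240 / ε = 240 * (1 / ε) := by ring
    linarith
  have h2 : max 1 (1 / ε) ^ 2 ≤ max 1 (1 / ε ^ 2) := by
    rcases max_choice 1 (1 / ε) with h | h <;> rw [h]
    · simp
    · rw [div_pow, one_pow]; exact le_max_right _ _
  calc ((⌊240 / ε⌋₊ + 241 : ℕ) : ℝ) ^ 2 ≤ (481 * max 1 (1 / ε)) ^ 2 := by gcongr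
    _ = 231361 * max 1 (1 / ε) ^ 2 := by ring
    _ ≤ 231361 * max 1 (1 / ε ^ 2) := by gcongr
    _ = _ := by norm_num

theorem eval_resolution {s : State} {ε : ℝ} (hε : 0 < ε) (h : s.reg 1 = ε) :
    (Expr.add (.floor (.div (.const 240) (.reg 1))) (.const 241)).eval s =
      ((⌊240 / ε⌋₊ + 241 : ℕ) : ℝ) := by
  simp only [Expr.eval, h]
  push_cast
  rw [natCast_floor_eq_intCast_floor (by positivity)]

theorem stores_of_image {s : State} {A : Finset ℕ} {e : ℕ → ℕ} {f : ℕ → Plane}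
    (hf : Set.InjOn f A) (h0 : s.reg 0 = A.card) (he : (Finset.range A.card).image e = A)
    (hdata : ∀ j < A.card, s.arr 0 j = f (e j) 0 ∧ s.arr 1 j = f (e j) 1) :
    s.Stores (A.image f) := by
  have hcard : (A.image f).card = A.card := Finset.card_image_of_injOn hf
  have hmem : ∀ j < A.card, e j ∈ A := fun j hj => by
    rw [← he]; exact Finset.mem_image_of_mem _ (Finset.mem_range.2 hj)
  have hinj : Set.InjOn e (Finset.range A.card) := by
    rw [← Finset.card_image_iff, he, Finset.card_range]
  let g : Fin (A.image f).card → (A.image f : Finset Plane) := fun j =>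
    ⟨f (e j), Finset.mem_image_of_mem _ (hmem j (hcard ▸ j.2))⟩
  have hg : Function.Bijective g := by
    rw [Fintype.bijective_iff_injective_and_card]
    refine ⟨fun i j hij => ?_, by simp⟩
    have hi : (i : ℕ) < A.card := hcard ▸ i.2
    have hj : (j : ℕ) < A.card := hcard ▸ j.2
    have h1 := hf (hmem i hi) (hmem j hj) (congrArg Subtype.val hij)
    exact Fin.ext (hinj (by simpa using hi) (by simpa using hj) h1)
  exact ⟨by rw [hcard, h0], Equiv.ofBijective g hg, fun i => hdata i (hcard ▸ i.2)⟩

/-! ### Correctness and running time -/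

theorem exists_linear_time_bound : ∃ c : ℕ,
      ∀ (S : Finset Plane) (ε : ℝ) (hε : 0 < ε) (s : State),
        s.Stores S → s.reg 1 = ε →
          ∃ (t : ℕ) (s' : State) (Q : Finset Plane),
            Runs certProg s t s' ∧
            t ≤ c * (S.card + 1) ∧
            s'.Stores Q ∧
            IsCertificate ε hε S Q ∧
            (Q.card : ℝ) ≤ c * max 1 (1 / ε ^ 2) := by
  obtain ⟨k, hk⟩ := Input.achieves_seed
  obtain ⟨K, hK1, hK⟩ := exists_natFloor_add_sq_le
  refine ⟨K * (k + 1) + 100, fun S ε hε s hS hs1 => ?_⟩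
  obtain ⟨hs0, p, hp⟩ := hS
  set m := ⌊240 / ε⌋₊ + 241 with hm
  have hmsq := hK ε hε
  rw [← hm] at hmsq
  set s₁ := s.setReg 6 m with hs₁
  have hset : Runs (.set 6 (.add (.floor (.div (.const 240) (.reg 1))) (.const 241))) s 7 s₁ := by
    have := Runs.set s 6 (.add (.floor (.div (.const 240) (.reg 1))) (.const 241))
    rwa [eval_resolution hε hs1] at this
  clear_value m
  have hmax : (0 : ℝ) ≤ max 1 (1 / ε ^ 2) := zero_le_one.trans (le_max_left _ _)
  have htest : Test.Holds s₁ (.le (.mul (.reg 6) (.reg 6)) (.reg 0)) ↔ m ^ 2 ≤ S.card := by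
    simp only [Test.Holds, Expr.eval, hs₁, State.setReg_reg, Function.update_self]
    rw [Function.update_of_ne (by omega), hs0, sq]
    exact_mod_cast Iff.rfl
  by_cases hsmall : m ^ 2 ≤ S.card
  swap
  · refine ⟨_, s₁, S, .seq hset (.branch_false (fun h => hsmall (htest.1 h)) (.skip s₁)), ?_,
      ⟨by simp [hs₁, hs0], p, hp⟩, isCertificate_self hε S, ?_⟩
    · have := Nat.zero_le (K * (k + 1) * (S.card + 1))
      simp only [Test.cost, Expr.cost]
      linarith
    · have h1 : (S.card : ℝ) ≤ (m : ℝ) ^ 2 := by exact_mod_cast (not_le.1 hsmall).le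
      have h2 : 0 ≤ (K : ℝ) * k * max 1 (1 / ε ^ 2) := by positivity
      push_cast
      linarith
  let I : Input := ⟨fun i => (s.arr 0 i, s.arr 1 i), S.card, m, by omega, hsmall⟩
  obtain ⟨t₁, s₂, hr₁, ht₁, hf, hzero⟩ := halts_init (s := s₁) (n := S.card) (by simp [hs₁, hs0])
  have hready : I.Ready s₂ ∅ :=
    { reg0 := by rw [hf.reg 0 (by omega)]; simp [hs₁, hs0, I]
      reg6 := by rw [hf.reg 6 (by omega)]; simp [hs₁, I]
      arr0 := fun i => by rw [hf.arr0]; rfl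
      arr1 := fun i => by rw [hf.arr1]; rfl
      sub := by simp
      marks := fun i hi => by simp [hzero i hi] }
  obtain ⟨t₂, s₃, A, hr₂, ht₂, hready₃, -, hcard, hseed⟩ := hk I s₂ ∅ hready
  obtain ⟨t₃, s₄, hr₃, ht₃, h0, e, he, hdata⟩ :=
    halts_compact hready₃.sub hready₃.reg0 hready₃.marks
  let f : ℕ → Plane := fun i => if h : i < S.card then (p ⟨i, h⟩ : Plane) else 0
  have hfI : ∀ i < S.card, toPair (f i) = I.P i := fun i hi => by
    simp only [f, dif_pos hi, toPair, I]
    exact Prod.ext (hp ⟨i, hi⟩).1.symm (hp ⟨i, hi⟩).2.symm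
  have hAlt : ∀ i ∈ A, i < S.card := fun i hi => Finset.mem_range.1 (hready₃.sub hi)
  have hfinj : Set.InjOn f A := fun i hi j hj h => by
    simp only [f, dif_pos (hAlt i hi), dif_pos (hAlt j hj)] at h
    have := p.injective (Subtype.ext h)
    simpa using this
  refine ⟨_, s₄, A.image f, .seq hset (.branch_true (htest.2 hsmall) (.seq hr₁ (.seq hr₂ hr₃))), ?_,
    stores_of_image hfinj h0 he fun j hj => ?_, ?_, ?_⟩
  · have : I.n = S.card := rfl
    rw [this] at ht₂ ht₃
    have hkK : k ≤ K * (k + 1) := (Nat.le_succ k).trans (Nat.le_mul_of_pos_left _ hK1)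
    have := Nat.mul_le_mul_right (S.card + 1) hkK
    simp only [Test.cost, Expr.cost]
    linarith
  · have hej : e j ∈ A := by rw [← he]; exact Finset.mem_image_of_mem _ (Finset.mem_range.2 hj)
    obtain ⟨d0, d1⟩ := hdata j hj
    have := hfI (e j) (hAlt _ hej)
    rw [d0, d1, hready₃.arr0, hready₃.arr1, ← this]
    exact ⟨rfl, rfl⟩
  · refine isCertificate_of_seed (m := m) hε (by rw [hm]; positivity) ?_ ?_ ?_
    · have := Nat.lt_floor_add_one (240 / ε)
      rw [hm]; push_cast; linarith
    · intro q hq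
      obtain ⟨i, hi, rfl⟩ := Finset.mem_image.1 hq
      simp only [f, dif_pos (hAlt i hi)]
      exact (p ⟨i, hAlt i hi⟩).2
    · have hSI : toPair '' (S : Set Plane) = I.S := by
        ext q
        constructor
        · rintro ⟨x, hx, rfl⟩
          refine ⟨p.symm ⟨x, hx⟩, (p.symm ⟨x, hx⟩).2, ?_⟩
          rw [← hfI _ (p.symm ⟨x, hx⟩).2]
          simp [f]
        · rintro ⟨i, hi, rfl⟩
          refine ⟨f i, ?_, hfI i hi⟩
          have hi' : i < S.card := hi
          simp only [f, dif_pos hi']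
          exact (p ⟨i, hi⟩).2
      have hQI : toPair '' ((A.image f : Finset Plane) : Set Plane) = I.Q A := by
        ext q
        constructor
        · rintro ⟨x, hx, rfl⟩
          obtain ⟨i, hi, rfl⟩ := Finset.mem_image.1 (Finset.mem_coe.1 hx)
          exact ⟨i, hi, (hfI i (hAlt i hi)).symm⟩
        · rintro ⟨i, hi, rfl⟩
          exact ⟨f i, Finset.mem_coe.2 (Finset.mem_image_of_mem _ hi), hfI i (hAlt i hi)⟩
      rw [hSI, hQI]
      exact hseed
  · have h1 : (A.image f).card ≤ k * m ^ 2 :=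
      Finset.card_image_le.trans (by simpa using hcard)
    have h2 : ((A.image f).card : ℝ) ≤ k * (m : ℝ) ^ 2 := by exact_mod_cast h1
    have h3 : (k : ℝ) * (m : ℝ) ^ 2 ≤ k * (K * max 1 (1 / ε ^ 2)) := by gcongr
    have h4 : 0 ≤ (K : ℝ) * max 1 (1 / ε ^ 2) := by positivity
    push_cast
    linarith

end TwoLineCenter

theorem mainTheorem7 :
    ∃ (A : TwoLineCenter.Program) (C : ℝ),
      ∀ (S : Finset TwoLineCenter.Plane) (ε : ℝ) (hε : 0 < ε) (s : TwoLineCenter.State),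
        s.Stores S → s.reg 1 = ε →
          ∃ (t : ℕ) (s' : TwoLineCenter.State) (Q : Finset TwoLineCenter.Plane),
            TwoLineCenter.Runs A s t s' ∧
            (t : ℝ) ≤ C * ((S.card : ℝ) + 1) ∧
            s'.Stores Q ∧
            TwoLineCenter.IsCertificate ε hε S Q ∧
            (Q.card : ℝ) ≤ C * max 1 (1 / ε ^ 2) := by
  obtain ⟨c, hc⟩ := TwoLineCenter.exists_linear_time_bound
  refine ⟨TwoLineCenter.certProg, c, fun S ε hε s hS hs => ?_⟩
  obtain ⟨t, s', Q, hr, ht, h⟩ := hc S ε hε s hS hs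
  exact ⟨t, s', Q, hr, by exact_mod_cast ht, h⟩
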